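/- A measure is called a translation invariant Borel measure on $\mathbb{R}$ if it is defined on a $\sigma$-algebra containing the Borel sets of $\mathbb{R}$ and is invariant under all translations. A nonempty Borel set $B\subset\mathbb{R}$ is called immeasurable if for every translation invariant Borel measure on $\mathbb{R}$ it is either null or non-$\sigma$-finite. Let $\dim_H$ denote Hausdorff dimension and $\dim_p$ packing dimension (that is, upper packing dimension $\inf\{\sup_n\overline{\dim}_M A_n : A\subset\bigcup_{n} A_n\}$, the infimum over countable covers, where $\overline{\dim}_M$ is upper Minkowski dimension). A Cantor set is a set homeomorphic to the middle-thirds Cantor set. For $\alpha\ge 0$ let $G_\alpha$ be the Erdős–Volkmann group of all real numbers of the form $x=\sum_{k\ge 0}a_k/k!$ (a convergent series) with integers $a_k$ for which there are $k_0,\kappa\in\mathbb{N}$ with $|a_k|\le\kappa k^{\alpha}$ for all $k\ge k_0$. Theorem. (1) For every $0\le\alpha\le 1$ there is an immeasurable additive subgroup $G$ of $\mathbb{R}$ with $\dim_H G=\dim_p G=\alpha$. (2) $G_\alpha\subset G_\beta$ whenever $0\le\alpha\le\beta$, and for $0\le\alpha<1$ the group $G_\alpha$ is $F_\sigma$ and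 satisfies $\dim_H G_\alpha=\dim_p G_\alpha=\alpha$. (3) For the typical nonempty compact set $C\subset\mathbb{R}$ (that is, for comeager many $C$ in the space of nonempty compact subsets of $\mathbb{R}$ with the Hausdorff metric), $C$ is a Cantor set that is linearly independent over $\mathbb{Q}$, and there are a Cantor set $K\subset C$ with $\dim_p K=0$ and a Borel set $B\subset K$ that is not $F_\sigma$ such that the group $H$ generated by $B$ has the following properties. The group $H$ is Borel, not $F_\sigma$, and $\dim_p H=0$. For every $0\le\alpha<1$ we have $G_\alpha\cap H=\{0\}$, and $G_\alpha+H$ is a Borel, non-$F_\sigma$, immeasurable group with $\dim_H(G_\alpha+H)=\dim_p(G_\alpha+H)=\alpha$. Finally, $\bigcup_{n\ge 1}(G_{1-1/n}+H)$ is an immeasurable group with $\dim_H=\dim_p=1$. -/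

import Mathlib

open Set Filter Topology MeasureTheory
open scoped NNReal ENNReal Nat

/-- `B ⊆ ℝ` is immeasurable: it is a nonempty Borel set which is null or non-`σ`-finite for every
translation invariant Borel measure on `ℝ`.  A Borel measure is a measure on an arbitrary
`σ`-algebra `m` containing the Borel sets.  Translation invariance is required only where both
sides are in the domain of `μ`, so every measure with a translation invariant domain
is included. -/
def Immeasurable (B : Set ℝ) : Prop :=
  B.Nonempty ∧ MeasurableSet B ∧
    ∀ (m : MeasurableSpace ℝ), borel ℝ ≤ m → ∀ μ : @Measure ℝ m,
      (∀ (t : ℝ) (A : Set ℝ), MeasurableSet[m] A → MeasurableSet[m] ((fun x => x + t) '' A) →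
        μ ((fun x => x + t) '' A) = μ A) →
      μ B = 0 ∨
        ¬ ∃ S : ℕ → Set ℝ, (∀ n, MeasurableSet[m] (S n) ∧ μ (S n) < ∞) ∧ B ⊆ ⋃ n, S n

/-- `F_σ` sets: countable unions of closed sets. -/
def IsFSigmaSet {X : Type*} [TopologicalSpace X] (A : Set X) : Prop :=
  ∃ F : ℕ → Set X, (∀ n, IsClosed (F n)) ∧ A = ⋃ n, F n

/-- Cantor sets: sets homeomorphic to the classical middle-thirds Cantor set. -/
def IsCantorSpace {X : Type*} [TopologicalSpace X] (A : Set X) : Prop :=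
  Nonempty (A ≃ₜ cantorSet)

/-- The upper Minkowski (box-counting) dimension
`inf {s ≥ 0 : N(A, ε) ε ^ s → 0 as ε → 0+}`, where `N(A, ε)` is the least number of closed balls
of radius `ε` that cover `A`; it is `∞` if `A` is not totally bounded. -/
noncomputable def upperMinkowskiDim {X : Type*} [PseudoMetricSpace X] (A : Set X) : ℝ≥0∞ :=
  ⨅ (s : ℝ≥0) (_ : Tendsto
      (fun ε : ℝ≥0 => (Metric.externalCoveringNumber ε A : ℝ≥0∞) * (ε : ℝ≥0∞) ^ (s : ℝ))
      (𝓝[>] 0) (𝓝 0)), (s : ℝ≥0∞)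

/-- The (upper) packing dimension: the infimum of `sup_n (upper Minkowski dimension of F n)`
over all countable covers `(F n)` of `A`. -/
noncomputable def packingDim {X : Type*} [PseudoMetricSpace X] (A : Set X) : ℝ≥0∞ :=
  ⨅ (F : ℕ → Set X) (_ : A ⊆ ⋃ n, F n), ⨆ n, upperMinkowskiDim (F n)

/-- The Erdős–Volkmann group with parameter `α`: the real numbers `x = ∑ a_k / k!` with integers
`a_k` such that `|a_k| ≤ κ k ^ α` for all `k ≥ k₀`, for some `κ` and `k₀` depending on `x`. -/
def erdosVolkmannGroup (α : ℝ) : AddSubgroup ℝ where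
  carrier := {x | ∃ a : ℕ → ℤ, (∃ k₀ κ : ℕ, ∀ k ≥ k₀, |(a k : ℝ)| ≤ κ * (k : ℝ) ^ α) ∧
    HasSum (fun k => (a k : ℝ) / (k ! : ℝ)) x}
  zero_mem' := ⟨fun _ => 0, ⟨0, 0, by simp⟩, by simp [hasSum_zero]⟩
  add_mem' := by
    rintro x y ⟨a, ⟨k, κ, ha⟩, hx⟩ ⟨b, ⟨l, ν, hb⟩, hy⟩
    refine ⟨fun n => a n + b n, ⟨max k l, κ + ν, fun n hn => ?_⟩, ?_⟩
    · have h1 := ha n (le_trans (le_max_left _ _) hn)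
      have h2 := hb n (le_trans (le_max_right _ _) hn)
      push_cast
      calc |(a n : ℝ) + b n| ≤ |(a n : ℝ)| + |(b n : ℝ)| := abs_add_le _ _
        _ ≤ _ := by linarith
    · simpa [add_div] using hx.add hy
  neg_mem' := by
    rintro x ⟨a, ⟨k, κ, ha⟩, hx⟩
    refine ⟨fun n => - a n, ⟨k, κ, fun n hn => ?_⟩, ?_⟩
    · simpa using ha n hn
    · simpa [neg_div] using hx.neg

open scoped Pointwise

/-! Everything about measures rests on one principle: a Borel subgroup `G` that is not `F_σ` is
immeasurable. Suppose an invariant measure is `σ`-finite and nonzero on `G`. Cutting it down to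
pieces of finite measure gives countably many finite Borel measures, and one of them charges a
compact `K ⊆ G`. By invariance every translate of `K` by an element of `G` is charged by one of
them, so a maximal disjoint family of such translates is countable. By maximality `G` is a countable
union of translates of `K - K`, hence `F_σ`.

It remains to build Borel, non-`F_σ` groups of prescribed dimension. The group `G_α` supplies the
dimension. It is a countable union of compact pieces, and counting digit strings bounds their box
dimension by `α`. Conversely, mixed radix digits below about `k ^ α / 2`, read as factorial digits,
embed `[0, 1)` into `G_α` with an inverse that is Hölder of every exponent below `α`, so the
Hausdorff dimension is at least `α`.

The group `H` supplies the descriptive complexity. The rational span `W` of all `G_α` with `α < 1`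
is `F_σ` and Lebesgue null, so a Baire category argument makes the typical compact `C` independent
modulo `W` (`eventually_residual_linearIndepOn`); it is also perfect, hence a Cantor set. Inside `C`
lies a Cantor set `K` of box dimension zero, and `B ⊆ K` is a copy of the binary sequences with
infinitely many ones, which is Borel but not `F_σ`. If `H` is generated by `B` and `G ⊆ W`,
independence gives `(G + H) ∩ C = B`, so `G + H` is not `F_σ`. Independence also makes the
parametrization of `G + H` by ordered tuples injective, so `G + H` is Borel by the Lusin–Souslin
theorem. Since `H` is covered by countably many sets `p • K - q • K` of box dimension zero, adding
it does not change the dimension. -/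

theorem isFSigmaSet_iUnion {X ι : Type*} [TopologicalSpace X] [Countable ι] {F : ι → Set X}
    (hF : ∀ i, IsClosed (F i)) : IsFSigmaSet (⋃ i, F i) := by
  rcases isEmpty_or_nonempty ι with h | h
  · exact ⟨fun _ => ∅, fun _ => isClosed_empty, by simp⟩
  · obtain ⟨e, he⟩ := exists_surjective_nat ι
    exact ⟨fun n => F (e n), fun n => hF _, (he.iUnion_comp F).symm⟩

theorem IsFSigmaSet.measurableSet {X : Type*} [TopologicalSpace X] [MeasurableSpace X]
    [OpensMeasurableSpace X] {A : Set X} (hA : IsFSigmaSet A) : MeasurableSet A := by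
  obtain ⟨F, hF, rfl⟩ := hA
  exact MeasurableSet.iUnion fun n => (hF n).measurableSet

theorem IsFSigmaSet.preimage {X Y : Type*} [TopologicalSpace X] [TopologicalSpace Y] {A : Set Y}
    (hA : IsFSigmaSet A) {f : X → Y} (hf : Continuous f) : IsFSigmaSet (f ⁻¹' A) := by
  obtain ⟨F, hF, rfl⟩ := hA
  exact ⟨fun n => f ⁻¹' F n, fun n => (hF n).preimage hf, preimage_iUnion⟩

/-! ### Immeasurable subgroups -/

/-- A subgroup containing a compact set whose translates all have positive measure for one of
countably many finite measures is `F_σ`. -/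
theorem isFSigmaSet_of_forall_exists_pos (G : AddSubgroup ℝ) {K : Set ℝ} (hK : IsCompact K)
    (hKG : K ⊆ G) (ν : ℕ → Measure ℝ) [∀ n, IsFiniteMeasure (ν n)]
    (h : ∀ g ∈ G, ∃ n, 0 < ν n ((fun x => x + g) '' K)) : IsFSigmaSet (G : Set ℝ) := by
  -- A maximal set of elements of `G` whose translates of `K` are pairwise disjoint.
  obtain ⟨T, hT⟩ := zorn_subset
    {T : Set ℝ | T ⊆ G ∧ T.PairwiseDisjoint (fun g => (fun x => x + g) '' K)} (by
      intro c hc hchain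
      refine ⟨⋃₀ c, ⟨sUnion_subset fun s hs => (hc hs).1, ?_⟩, fun s hs => subset_sUnion_of_mem hs⟩
      exact (pairwiseDisjoint_sUnion hchain.directedOn).2 fun s hs => (hc hs).2)
  have hclosed : ∀ g : ℝ, IsClosed ((fun x => x + g) '' K) := fun g =>
    (hK.image (by fun_prop)).isClosed
  have hcount : T.Countable := by
    have hn : ∀ n, {g : T | 0 < ν n ((fun x => x + (g : ℝ)) '' K)}.Countable := fun n =>
      Measure.countable_meas_pos_of_disjoint_iUnion (fun g => (hclosed g).measurableSet)
        (fun a b hab => hT.prop.2 a.2 b.2 (fun h => hab (Subtype.ext h)))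
    have : (univ : Set T).Countable := by
      refine (countable_iUnion hn).mono fun g _ => ?_
      obtain ⟨n, hn⟩ := h g (hT.prop.1 g.2)
      exact mem_iUnion.2 ⟨n, hn⟩
    exact countable_coe_iff.1 (countable_univ_iff.1 this)
  have := hcount.to_subtype
  have hKne : K.Nonempty := by
    obtain ⟨n, hn⟩ := h 0 G.zero_mem
    exact (image_nonempty.1 (nonempty_of_measure_ne_zero hn.ne'))
  have hGeq : (G : Set ℝ) = ⋃ g : T, (fun x => x + (g : ℝ)) '' (K - K) := by
    apply Subset.antisymm
    · intro g hg
      -- By maximality `K + g` meets some `K + t`; a common point `a + t = b + g` gives `g = (a - b)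
      -- + t`.
      have hex : ∃ t ∈ T, ((fun x => x + t) '' K ∩ (fun x => x + g) '' K).Nonempty := by
        by_contra! hcon
        have hins : insert g T ∈
            {T : Set ℝ | T ⊆ G ∧ T.PairwiseDisjoint (fun g => (fun x => x + g) '' K)} := by
          refine ⟨insert_subset hg hT.prop.1, (pairwiseDisjoint_insert).2 ⟨hT.prop.2, ?_⟩⟩
          intro t ht _
          exact (disjoint_iff_inter_eq_empty.2 (hcon t ht)).symm
        have hgT : g ∈ T := hT.le_of_ge hins (subset_insert g T) (mem_insert g T)
        have := hcon g hgT
        rw [inter_self] at this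
        exact (hKne.image _).ne_empty this
      obtain ⟨t, ht, y, ⟨a, ha, rfl⟩, b, hb, hab⟩ := hex
      refine mem_iUnion.2 ⟨⟨t, ht⟩, a - b, sub_mem_sub ha hb, ?_⟩
      simp only at hab ⊢
      linarith
    · refine iUnion_subset fun g => ?_
      rintro _ ⟨_, ⟨a, ha, b, hb, rfl⟩, rfl⟩
      exact G.add_mem (G.sub_mem (hKG ha) (hKG hb)) (hT.prop.1 g.2)
  rw [hGeq]
  exact isFSigmaSet_iUnion fun g => (((sub_eq_add_neg K K).symm ▸ hK.add hK.neg : IsCompact (K - K)).image (by fun_prop)).isClosed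

/-- Inner regularity provides the compact `K`. Only quasi-invariance of the whole family is needed:
the individual `ν n` are restrictions and need not be invariant. -/
theorem isFSigmaSet_of_finite_measures (G : AddSubgroup ℝ) (hG : MeasurableSet (G : Set ℝ))
    (ν : ℕ → Measure ℝ) (hfin : ∀ n, IsFiniteMeasure (ν n))
    (hinv : ∀ g ∈ G, ∀ A : Set ℝ, MeasurableSet A → A ⊆ G →
      MeasurableSet ((fun x => x + g) '' A) → (∀ n, ν n ((fun x => x + g) '' A) = 0) →
      ∀ n, ν n A = 0)
    (hpos : ∃ n, ν n G ≠ 0) : IsFSigmaSet (G : Set ℝ) := by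
  obtain ⟨n, hn⟩ := hpos
  obtain ⟨K, hKG, hK, hKpos⟩ := hG.exists_lt_isCompact (pos_iff_ne_zero.2 hn)
  refine isFSigmaSet_of_forall_exists_pos G hK hKG ν fun g hg => ?_
  by_contra! hcon
  refine hKpos.ne' (hinv g hg K hK.measurableSet hKG
    (hK.image (by fun_prop)).measurableSet (fun k => le_antisymm (hcon k) zero_le) n)

/-- The sets `S n` need not be Borel, so the measure is restricted on `m` first and only then
trimmed to the Borel sets, where regularity is available. -/
theorem exists_finite_measures_eq_inter (m : MeasurableSpace ℝ) (hm : borel ℝ ≤ m)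
    (μ : @Measure ℝ m) (S : ℕ → Set ℝ) (hS : ∀ n, μ (S n) < ∞) :
    ∃ ν : ℕ → @Measure ℝ (borel ℝ), (∀ n, @IsFiniteMeasure ℝ (borel ℝ) (ν n)) ∧
      ∀ n A, MeasurableSet[borel ℝ] A → ν n A = μ (A ∩ S n) := by
  have key : ∀ n A, MeasurableSet[borel ℝ] A →
      (@Measure.trim ℝ (borel ℝ) m (μ.restrict (S n)) hm) A = μ (A ∩ S n) := fun n A hA => by
    rw [trim_measurableSet_eq hm hA, Measure.restrict_apply (hm _ hA)]
  refine ⟨fun n => @Measure.trim ℝ (borel ℝ) m (μ.restrict (S n)) hm, fun n => ?_, key⟩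
  refine @IsFiniteMeasure.mk ℝ (borel ℝ) _ ?_
  rw [key n univ (@MeasurableSet.univ ℝ (borel ℝ)), univ_inter]
  exact hS n

/-- A Borel subgroup of `ℝ` that is not `F_σ` is immeasurable. -/
theorem immeasurable_of_not_isFSigmaSet (G : AddSubgroup ℝ) (hG : MeasurableSet (G : Set ℝ))
    (hF : ¬ IsFSigmaSet (G : Set ℝ)) : Immeasurable (G : Set ℝ) := by
  refine ⟨⟨0, G.zero_mem⟩, hG, fun m hm μ hμ => ?_⟩
  by_contra! hcon
  obtain ⟨h0, S, hS, hGS⟩ := hcon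
  obtain ⟨ν, hfin, hν⟩ := exists_finite_measures_eq_inter m hm μ S fun n => (hS n).2
  have hzero : ∀ A : Set ℝ, MeasurableSet[borel ℝ] A → A ⊆ G → (∀ n, ν n A = 0) → μ A = 0 := by
    intro A hA hAG h
    have : A ⊆ ⋃ n, (A ∩ S n) := fun x hx => by
      rw [← inter_iUnion]; exact ⟨hx, hGS (hAG hx)⟩
    refine measure_mono_null this (measure_iUnion_null fun n => ?_)
    rw [← hν n A hA]; exact h n
  refine hF (isFSigmaSet_of_finite_measures G hG ν hfin ?_ ?_)
  · intro g hg A hA hAG hA' h n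
    have hsub : (fun x => x + g) '' A ⊆ G := by
      rintro _ ⟨x, hx, rfl⟩; exact G.add_mem (hAG hx) hg
    have h1 := hzero _ hA' hsub h
    rw [hμ g A (hm _ hA) (hm _ hA')] at h1
    rw [hν n A hA]
    exact measure_mono_null inter_subset_left h1
  · by_contra! hcon
    exact h0 (hzero G hG Subset.rfl hcon)

/-! ### Box counting bounds -/

/-- For every `t > s`, the set `A` can be covered by at most `ε ^ (-t)` intervals of radius `ε`,
for all small `ε`. -/
def HasBoxBound (A : Set ℝ) (s : ℝ) : Prop :=
  ∀ t > s, ∀ᶠ ε in 𝓝[>] (0 : ℝ), ∃ S : Finset ℝ,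
    (∀ a ∈ A, ∃ x ∈ S, |a - x| ≤ ε) ∧ (S.card : ℝ) ≤ ε ^ (-t)

theorem HasBoxBound.mono {A B : Set ℝ} {s : ℝ} (hB : HasBoxBound B s) (h : A ⊆ B) :
    HasBoxBound A s := fun t ht => by
  filter_upwards [hB t ht] with ε ⟨S, h1, h2⟩
  exact ⟨S, fun a ha => h1 a (h ha), h2⟩

theorem HasBoxBound.of_le {A : Set ℝ} {s t : ℝ} (hA : HasBoxBound A s) (h : s ≤ t) :
    HasBoxBound A t := fun u hu => hA u (h.trans_lt hu)

theorem HasBoxBound.neg {A : Set ℝ} {s : ℝ} (hA : HasBoxBound A s) : HasBoxBound (-A) s :=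
    fun t ht => by
  filter_upwards [hA t ht] with ε ⟨S, h1, h2⟩
  refine ⟨S.image Neg.neg, fun a ha => ?_, le_trans (by exact_mod_cast Finset.card_image_le) h2⟩
  obtain ⟨x, hx, hax⟩ := h1 (-a) ha
  refine ⟨-x, Finset.mem_image_of_mem _ hx, ?_⟩
  rw [← abs_neg]; convert hax using 2; ring

theorem hasBoxBound_singleton (x : ℝ) : HasBoxBound {x} 0 := fun t ht => by
  filter_upwards [Ioo_mem_nhdsGT (zero_lt_one' ℝ)] with ε hε
  refine ⟨{x}, fun a ha => ⟨x, by simp, ?_⟩, ?_⟩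
  · rw [mem_singleton_iff.1 ha, sub_self, abs_zero]; exact hε.1.le
  · simpa using Real.one_le_rpow_of_pos_of_le_one_of_nonpos hε.1 hε.2.le (by linarith)

theorem HasBoxBound.add {A B : Set ℝ} {s t : ℝ} (hA : HasBoxBound A s) (hB : HasBoxBound B t) :
    HasBoxBound (A + B) (s + t) := fun u hu => by
  -- Two thirds of the slack go to the exponents `s + d` and `t + d`; the last third absorbs the
  -- constant caused by halving `ε`.
  set d := (u - (s + t)) / 3 with hd
  have hd0 : 0 < d := by rw [hd]; linarith
  have hhalf : Tendsto (fun ε : ℝ => ε / 2) (𝓝[>] 0) (𝓝[>] 0) := by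
    refine tendsto_nhdsWithin_iff.2 ⟨?_, ?_⟩
    · have : Tendsto (fun ε : ℝ => ε / 2) (𝓝 0) (𝓝 (0 / 2)) := by
        apply Continuous.tendsto; fun_prop
      rw [zero_div] at this
      exact this.mono_left nhdsWithin_le_nhds
    · filter_upwards [self_mem_nhdsWithin] with ε hε
      exact half_pos (mem_Ioi.1 hε)
  have hpow : ∀ᶠ ε in 𝓝[>] (0 : ℝ), ε ^ d ≤ 2 ^ (-(s + t + 2 * d)) := by
    have h0 : Tendsto (fun ε : ℝ => ε ^ d) (𝓝[>] 0) (𝓝 0) := by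
      have := (Real.continuousAt_rpow_const 0 d (Or.inr hd0.le)).tendsto
      rw [Real.zero_rpow hd0.ne'] at this
      exact this.mono_left nhdsWithin_le_nhds
    exact (h0.eventually_lt_const (by positivity)).mono fun _ h => h.le
  filter_upwards [hhalf.eventually (hA (s + d) (by linarith)),
    hhalf.eventually (hB (t + d) (by linarith)), hpow, self_mem_nhdsWithin]
    with ε ⟨S, hS, hSc⟩ ⟨T, hT, hTc⟩ hε hε0
  have hε0 : 0 < ε := hε0
  refine ⟨S + T, ?_, ?_⟩
  · rintro _ ⟨a, ha, b, hb, rfl⟩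
    obtain ⟨x, hx, hax⟩ := hS a ha
    obtain ⟨y, hy, hby⟩ := hT b hb
    refine ⟨x + y, Finset.add_mem_add hx hy, ?_⟩
    simp only
    calc |a + b - (x + y)| = |(a - x) + (b - y)| := by ring_nf
      _ ≤ |a - x| + |b - y| := abs_add_le _ _
      _ ≤ ε := by linarith
  · have h1 : ((S + T).card : ℝ) ≤ S.card * T.card := by exact_mod_cast Finset.card_add_le
    have h2 : (ε / 2) ^ (-(s + d)) * (ε / 2) ^ (-(t + d)) =
        ε ^ (-(s + t + 2 * d)) / 2 ^ (-(s + t + 2 * d)) := by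
      rw [← Real.rpow_add (by positivity), Real.div_rpow hε0.le (by norm_num)]
      congr 2 <;> ring
    have h3 : ε ^ (-u) = ε ^ (-(s + t + 2 * d)) / ε ^ d := by
      rw [← Real.rpow_sub hε0]; congr 1; rw [hd]; ring
    calc ((S + T).card : ℝ) ≤ S.card * T.card := h1
      _ ≤ (ε / 2) ^ (-(s + d)) * (ε / 2) ^ (-(t + d)) := by gcongr
      _ ≤ ε ^ (-u) := by
        rw [h2, h3]
        gcongr

theorem HasBoxBound.nsmul {A : Set ℝ} (hA : HasBoxBound A 0) (n : ℕ) : HasBoxBound (n • A) 0 := by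
  induction n with
  | zero => rw [zero_nsmul]; exact hasBoxBound_singleton 0
  | succ n ih => rw [succ_nsmul]; simpa using ih.add hA

theorem upperMinkowskiDim_le {A : Set ℝ} {s : ℝ} (hs : 0 ≤ s) (hA : HasBoxBound A s) :
    upperMinkowskiDim A ≤ ENNReal.ofReal s := by
  refine le_of_forall_gt fun b hb => ?_
  obtain ⟨t, ht1, ht2⟩ := ENNReal.lt_iff_exists_nnreal_btwn.1 hb
  have hst : s < t := by
    rw [← ENNReal.ofReal_coe_nnreal] at ht1
    exact (ENNReal.ofReal_lt_ofReal_iff_of_nonneg hs).1 ht1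
  refine lt_of_le_of_lt (iInf₂_le t ?_) ht2
  obtain ⟨r, hsr, hrt⟩ := exists_between hst
  have hcoe : Tendsto (fun ε : ℝ≥0 => (ε : ℝ)) (𝓝[>] 0) (𝓝[>] 0) := by
    refine tendsto_nhdsWithin_iff.2 ⟨?_, ?_⟩
    · exact (NNReal.continuous_coe.tendsto' 0 0 rfl).mono_left nhdsWithin_le_nhds
    · filter_upwards [self_mem_nhdsWithin] with ε hε
      exact NNReal.coe_pos.2 hε
  have hlim : Tendsto (fun ε : ℝ≥0 => ENNReal.ofReal ((ε : ℝ) ^ ((t : ℝ) - r)))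
      (𝓝[>] 0) (𝓝 0) := by
    have h0 : Tendsto (fun ε : ℝ => ε ^ ((t : ℝ) - r)) (𝓝[>] 0) (𝓝 0) := by
      have := (Real.continuousAt_rpow_const 0 ((t : ℝ) - r) (Or.inr (by linarith))).tendsto
      rw [Real.zero_rpow (by linarith)] at this
      exact this.mono_left nhdsWithin_le_nhds
    simpa using ENNReal.tendsto_ofReal (h0.comp hcoe)
  refine tendsto_of_tendsto_of_tendsto_of_le_of_le' tendsto_const_nhds hlim
    (Eventually.of_forall fun _ => zero_le) ?_
  filter_upwards [hcoe.eventually (hA r hsr), self_mem_nhdsWithin] with ε ⟨S, hS, hSc⟩ hε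
  have hε : 0 < ε := hε
  have hcov : Metric.IsCover ε A (S : Set ℝ) := by
    rw [Metric.isCover_iff_subset_iUnion_closedBall]
    intro a ha
    obtain ⟨x, hx, hax⟩ := hS a ha
    exact mem_iUnion₂.2 ⟨x, hx, by rwa [Metric.mem_closedBall, Real.dist_eq]⟩
  have h1 : (Metric.externalCoveringNumber ε A : ℝ≥0∞) ≤ (S.card : ℝ≥0∞) := by
    have := hcov.externalCoveringNumber_le_encard
    rw [Set.encard_coe_eq_coe_finsetCard] at this
    exact_mod_cast ENat.toENNReal_le.2 this
  have h2 : (S.card : ℝ≥0∞) ≤ ENNReal.ofReal ((ε : ℝ) ^ (-r)) := by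
    rw [← ENNReal.ofReal_natCast]; exact ENNReal.ofReal_le_ofReal hSc
  have h3 : (ε : ℝ≥0∞) ^ (t : ℝ) = ENNReal.ofReal ((ε : ℝ) ^ (t : ℝ)) := by
    rw [← ENNReal.ofReal_rpow_of_pos (NNReal.coe_pos.2 hε), ENNReal.ofReal_coe_nnreal]
  calc _ ≤ ENNReal.ofReal ((ε : ℝ) ^ (-r)) * ENNReal.ofReal ((ε : ℝ) ^ (t : ℝ)) := by
        rw [h3]; gcongr; exact h1.trans h2
    _ = _ := by
        rw [← ENNReal.ofReal_mul (by positivity), ← Real.rpow_add (by exact_mod_cast hε)]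
        congr 2; ring

theorem packingDim_le {ι : Type*} [Countable ι] {A : Set ℝ} {F : ι → Set ℝ} {s : ℝ} (hs : 0 ≤ s)
    (hAF : A ⊆ ⋃ i, F i) (hF : ∀ i, HasBoxBound (F i) s) :
    packingDim A ≤ ENNReal.ofReal s := by
  rcases isEmpty_or_nonempty ι with h | h
  · refine iInf₂_le_of_le (fun _ => ∅) (by simpa using hAF) (iSup_le fun _ => ?_)
    exact upperMinkowskiDim_le hs (((hasBoxBound_singleton 0).mono (empty_subset _)).of_le hs)
  · obtain ⟨e, he⟩ := exists_surjective_nat ι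
    refine iInf₂_le_of_le (fun n => F (e n)) (by rwa [he.iUnion_comp F]) (iSup_le fun n => ?_)
    exact upperMinkowskiDim_le hs (hF _)

/-- If `N(A, ε) ε ^ s` tends to zero, optimal covers by balls of radius `ε` have diameter sums
bounded by `2 ^ s`, so the `s`-dimensional Hausdorff measure is finite. -/
theorem dimH_le_upperMinkowskiDim (A : Set ℝ) : dimH A ≤ upperMinkowskiDim A := by
  refine le_iInf₂ fun s hs => dimH_le_of_hausdorffMeasure_ne_top (d := s) (ne_of_lt ?_)
  have hev : ∀ᶠ ε : ℝ≥0 in 𝓝[>] 0, ∃ S : Finset ℝ, A ⊆ ⋃ x : S, Metric.closedBall (x : ℝ) ε ∧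
      (S.card : ℝ≥0∞) * (ε : ℝ≥0∞) ^ (s : ℝ) ≤ 1 := by
    filter_upwards [hs.eventually_lt_const zero_lt_one, self_mem_nhdsWithin] with ε hε hε0
    have hε0 : 0 < ε := hε0
    have hne : Metric.externalCoveringNumber ε A ≠ ⊤ := by
      intro h
      rw [h, ENat.toENNReal_top, ENNReal.top_mul] at hε
      · exact not_top_lt hε
      · exact (ENNReal.rpow_pos (by exact_mod_cast hε0) ENNReal.coe_ne_top).ne'
    obtain ⟨C, hC, hCN⟩ : ∃ C : Set ℝ, Metric.IsCover ε A C ∧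
        C.encard = Metric.externalCoveringNumber ε A := by
      have : Nonempty {C : Set ℝ // Metric.IsCover ε A C} := by
        by_contra h
        rw [not_nonempty_iff] at h
        apply hne
        rw [Metric.externalCoveringNumber, iInf_subtype']
        exact iInf_of_empty _
      obtain ⟨C, hC⟩ := ENat.exists_eq_iInf fun C : {C : Set ℝ // Metric.IsCover ε A C} =>
        (C : Set ℝ).encard
      refine ⟨C, C.2, ?_⟩
      rw [hC, Metric.externalCoveringNumber, iInf_subtype']
    have hfin : C.Finite := by
      rw [← Set.encard_lt_top_iff, hCN]; exact hne.lt_top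
    lift C to Finset ℝ using hfin
    refine ⟨C, ?_, ?_⟩
    · have := hC.subset_iUnion_closedBall
      rwa [biUnion_eq_iUnion] at this
    · rw [← hCN, Set.encard_coe_eq_coe_finsetCard] at hε
      simpa using hε.le
  choose! S hS using fun (ε : ℝ≥0) (h : ∃ S : Finset ℝ,
    A ⊆ ⋃ x : S, Metric.closedBall (x : ℝ) ε ∧ (S.card : ℝ≥0∞) * (ε : ℝ≥0∞) ^ (s : ℝ) ≤ 1) => h
  have hdiam : ∀ (ε : ℝ≥0) (x : ℝ), Metric.ediam (Metric.closedBall x ε) ≤ 2 * ε := fun ε x => by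
    rw [← Metric.closedEBall_coe]
    exact Metric.ediam_closedEBall_le
  have hlim : Tendsto (fun ε : ℝ≥0 => 2 * (ε : ℝ≥0∞)) (𝓝[>] 0) (𝓝 0) := by
    have : Continuous fun ε : ℝ≥0 => 2 * (ε : ℝ≥0∞) :=
      (ENNReal.continuous_const_mul (by simp)).comp ENNReal.continuous_coe
    exact (this.tendsto' 0 0 (by simp)).mono_left nhdsWithin_le_nhds
  refine lt_of_le_of_lt (Measure.hausdorffMeasure_le_liminf_sum (s : ℝ) A _ hlim
    (fun ε (x : S ε) => Metric.closedBall (x : ℝ) ε)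
    (Eventually.of_forall fun ε x => hdiam _ _) (hev.mono fun ε h => (hS ε h).1)) ?_
  refine lt_of_le_of_lt (liminf_le_of_frequently_le' (x := (2 : ℝ≥0∞) ^ (s : ℝ))
    (Eventually.frequently (hev.mono fun ε h => ?_)))
    (ENNReal.rpow_lt_top_of_nonneg s.coe_nonneg (by simp))
  calc ∑ x : S ε, Metric.ediam (Metric.closedBall (x : ℝ) ε) ^ (s : ℝ)
      ≤ ∑ x : S ε, (2 * (ε : ℝ≥0∞)) ^ (s : ℝ) :=
        Finset.sum_le_sum fun x _ => ENNReal.rpow_le_rpow (hdiam _ _) s.coe_nonneg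
    _ = 2 ^ (s : ℝ) * ((S ε).card * (ε : ℝ≥0∞) ^ (s : ℝ)) := by
        rw [Finset.sum_const, nsmul_eq_mul, ENNReal.mul_rpow_of_nonneg _ _ s.coe_nonneg]
        simp only [Finset.card_univ, Fintype.card_coe]
        ring
    _ ≤ 2 ^ (s : ℝ) := by
        refine (mul_le_mul_right (hS ε h).2 _).trans ?_
        rw [mul_one]

theorem dimH_le_packingDim (A : Set ℝ) : dimH A ≤ packingDim A := by
  refine le_iInf₂ fun F hF => (dimH_mono hF).trans ?_
  rw [dimH_iUnion]
  exact iSup_mono fun n => dimH_le_upperMinkowskiDim _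

/-! ### The Erdős–Volkmann groups -/

theorem erdosVolkmannGroup_mono {α β : ℝ} (h : α ≤ β) :
    erdosVolkmannGroup α ≤ erdosVolkmannGroup β := by
  rintro x ⟨a, ⟨k₀, κ, ha⟩, hx⟩
  refine ⟨a, ⟨max k₀ 1, κ, fun k hk => (ha k ((le_max_left _ _).trans hk)).trans ?_⟩, hx⟩
  have : (1 : ℝ) ≤ k := by exact_mod_cast (le_max_right _ _).trans hk
  gcongr

/-- The numbers `∑ a_k / k!` with `|a_k| ≤ κ max(k, 1) ^ α` for all `k`. -/
def erdosVolkmannPiece (α : ℝ) (κ : ℕ) : Set ℝ :=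
  {x | ∃ a : ℕ → ℤ, (∀ k, |(a k : ℝ)| ≤ κ * ((max k 1 : ℕ) : ℝ) ^ α) ∧
    HasSum (fun k => (a k : ℝ) / (k ! : ℝ)) x}

theorem one_le_max_rpow {α : ℝ} (h0 : 0 ≤ α) (k : ℕ) : 1 ≤ ((max k 1 : ℕ) : ℝ) ^ α :=
  Real.one_le_rpow (by exact_mod_cast le_max_right k 1) h0

theorem max_rpow_le_two_pow {α : ℝ} (h1 : α ≤ 1) (k : ℕ) :
    ((max k 1 : ℕ) : ℝ) ^ α ≤ 2 ^ k := by
  have h : (1 : ℝ) ≤ ((max k 1 : ℕ) : ℝ) := by exact_mod_cast le_max_right k 1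
  calc ((max k 1 : ℕ) : ℝ) ^ α ≤ ((max k 1 : ℕ) : ℝ) ^ (1 : ℝ) :=
        Real.rpow_le_rpow_of_exponent_le h h1
    _ = ((max k 1 : ℕ) : ℝ) := Real.rpow_one _
    _ ≤ 2 ^ k := by exact_mod_cast max_le k.lt_two_pow_self.le Nat.one_le_two_pow

theorem erdosVolkmannGroup_eq_iUnion {α : ℝ} (h0 : 0 ≤ α) :
    (erdosVolkmannGroup α : Set ℝ) = ⋃ κ, erdosVolkmannPiece α κ := by
  apply Subset.antisymm
  · rintro x ⟨a, ⟨k₀, κ, ha⟩, hx⟩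
    set N := max k₀ 1
    -- The finitely many unrestricted digits are absorbed into the constant. This works since `max k
    -- 1 ^ α ≥ 1`, also at `k = 0`.
    refine mem_iUnion.2 ⟨κ + ∑ k ∈ Finset.range N, (a k).natAbs, a, fun k => ?_, hx⟩
    have h1 := one_le_max_rpow h0 k
    push_cast
    rcases lt_or_ge k N with hk | hk
    · have h2 : |(a k : ℝ)| ≤ ∑ k ∈ Finset.range N, ((a k).natAbs : ℝ) := by
        have := Finset.single_le_sum (f := fun k => ((a k).natAbs : ℝ)) (fun i _ => by positivity)
          (Finset.mem_range.2 hk)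
        simpa [Nat.cast_natAbs] using this
      calc |(a k : ℝ)| ≤ (κ + ∑ k ∈ Finset.range N, ((a k).natAbs : ℝ)) * 1 := by
            rw [mul_one]; linarith [(Nat.cast_nonneg κ : (0 : ℝ) ≤ κ)]
        _ ≤ _ := by
          have : ((max k 1 : ℕ) : ℝ) = max (k : ℝ) 1 := by push_cast; rfl
          rw [← this]
          gcongr
    · have hk1 : max k 1 = k := max_eq_left ((le_max_right _ _).trans hk)
      have : max (k : ℝ) 1 = k := by exact_mod_cast hk1
      rw [this]
      refine (ha k ((le_max_left _ _).trans hk)).trans ?_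
      gcongr
      simp only [le_add_iff_nonneg_right]
      positivity
  · refine iUnion_subset fun κ => ?_
    rintro x ⟨a, ha, hx⟩
    refine ⟨a, ⟨1, κ, fun k hk => ?_⟩, hx⟩
    simpa [max_eq_left hk] using ha k

theorem norm_div_factorial_le {α : ℝ} (h1 : α ≤ 1) {κ : ℕ} {k : ℕ} {z : ℤ}
    (hz : |(z : ℝ)| ≤ κ * ((max k 1 : ℕ) : ℝ) ^ α) :
    ‖(z : ℝ) / (k ! : ℝ)‖ ≤ κ * (2 ^ k / (k ! : ℝ)) := by
  rw [norm_div, Real.norm_eq_abs, Real.norm_natCast, ← mul_div_assoc]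
  gcongr
  exact hz.trans (by gcongr; exact max_rpow_le_two_pow h1 k)

theorem summable_two_pow_div_factorial (κ : ℝ) :
    Summable fun k : ℕ => κ * ((2 : ℝ) ^ k / (k ! : ℝ)) :=
  (Real.summable_pow_div_factorial 2).mul_left κ

/-- The admissible digit sequences form a product of finite sets, and the sum depends continuously
on them by the Weierstrass test. -/
theorem isCompact_erdosVolkmannPiece {α : ℝ} (h1 : α ≤ 1) (κ : ℕ) :
    IsCompact (erdosVolkmannPiece α κ) := by
  set P : Set (ℕ → ℤ) := {a | ∀ k, |(a k : ℝ)| ≤ κ * ((max k 1 : ℕ) : ℝ) ^ α}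
  have hP : IsCompact P := by
    have : P = Set.pi univ fun k => {z : ℤ | |(z : ℝ)| ≤ κ * ((max k 1 : ℕ) : ℝ) ^ α} := by
      ext a; simp [P]
    rw [this]
    refine isCompact_univ_pi fun k => Set.Finite.isCompact ?_
    refine (finite_Icc (-⌊(κ : ℝ) * ((max k 1 : ℕ) : ℝ) ^ α⌋)
      ⌊(κ : ℝ) * ((max k 1 : ℕ) : ℝ) ^ α⌋).subset fun z hz => ?_
    rw [mem_ofPred_eq, abs_le] at hz
    refine ⟨?_, Int.le_floor.2 hz.2⟩
    rw [neg_le]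
    refine Int.le_floor.2 ?_
    rw [Int.cast_neg]
    linarith [hz.1]
  have hcont : ContinuousOn (fun a : ℕ → ℤ => ∑' k, (a k : ℝ) / (k ! : ℝ)) P := by
    refine continuousOn_tsum (fun k => ?_) (summable_two_pow_div_factorial κ)
      fun k a ha => norm_div_factorial_le h1 (ha k)
    exact ((continuous_of_discreteTopology.comp (continuous_apply k)).div_const _).continuousOn
  convert hP.image_of_continuousOn hcont using 1
  ext x
  constructor
  · rintro ⟨a, ha, hx⟩
    exact ⟨a, ha, hx.tsum_eq⟩
  · rintro ⟨a, ha, rfl⟩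
    exact ⟨a, ha, (Summable.of_norm_bounded (summable_two_pow_div_factorial κ)
      fun k => norm_div_factorial_le h1 (ha k)).hasSum⟩

theorem isFSigmaSet_erdosVolkmannGroup {α : ℝ} (h0 : 0 ≤ α) (h1 : α ≤ 1) :
    IsFSigmaSet (erdosVolkmannGroup α : Set ℝ) := by
  rw [erdosVolkmannGroup_eq_iUnion h0]
  exact isFSigmaSet_iUnion fun κ => (isCompact_erdosVolkmannPiece h1 κ).isClosed

/-! ### Upper bound for the box dimension of the pieces -/

/-- Any positive power of `m !` outgrows every geometric sequence; this is what makes all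
exponential factors harmless in the dimension estimates. -/
theorem eventually_mul_pow_mul_factorial_rpow_le {α t : ℝ} (h : α < t) (C : ℝ) {D : ℝ}
    (hD : 0 < D) : ∀ᶠ m : ℕ in atTop, C * D ^ m * (m ! : ℝ) ^ α ≤ (m ! : ℝ) ^ t := by
  have hδ : 0 < t - α := by linarith
  have h1 : Tendsto (fun m : ℕ => (D ^ (1 / (t - α))) ^ m / (m ! : ℝ)) atTop (𝓝 0) :=
    FloorSemiring.tendsto_pow_div_factorial_atTop _
  have h2 : Tendsto (fun m : ℕ => C * ((D ^ (1 / (t - α))) ^ m / (m ! : ℝ)) ^ (t - α))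
      atTop (𝓝 0) := by
    have := (h1.rpow_const (p := t - α) (Or.inr hδ.le)).const_mul C
    rwa [Real.zero_rpow hδ.ne', mul_zero] at this
  filter_upwards [h2.eventually_le_const zero_lt_one] with m hm
  have hm0 : (0 : ℝ) < (m ! : ℝ) := by exact_mod_cast m.factorial_pos
  have h3 : ((D ^ (1 / (t - α))) ^ m) ^ (t - α) = D ^ m := by
    rw [← Real.rpow_natCast, ← Real.rpow_mul hD.le, ← Real.rpow_mul hD.le, ← Real.rpow_natCast]
    congr 1
    field_simp
  rw [Real.div_rpow (by positivity) hm0.le, h3, Real.rpow_sub hm0] at hm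
  have h4 : C * (D ^ m / ((m ! : ℝ) ^ t / (m ! : ℝ) ^ α)) =
      C * D ^ m * (m ! : ℝ) ^ α / (m ! : ℝ) ^ t := by field_simp
  rw [h4] at hm
  exact (div_le_one (by positivity)).1 hm

theorem natCast_add_one_rpow_le_two_pow {s : ℝ} (h1 : s ≤ 1) (m : ℕ) :
    ((m : ℝ) + 1) ^ s ≤ 2 ^ m := by
  calc ((m : ℝ) + 1) ^ s ≤ ((m : ℝ) + 1) ^ (1 : ℝ) :=
        Real.rpow_le_rpow_of_exponent_le (by linarith [(Nat.cast_nonneg m : (0 : ℝ) ≤ m)]) h1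
    _ = (m : ℝ) + 1 := Real.rpow_one _
    _ ≤ 2 ^ m := by exact_mod_cast m.lt_two_pow_self

/-- It suffices to count at the scales `R * 2 ^ n / n !`: consecutive scales differ by a factor that
is at most exponential, which any exponent `t > α` absorbs. -/
theorem hasBoxBound_of_factorial {A : Set ℝ} {α R D : ℝ} (h0 : 0 ≤ α) (h1 : α ≤ 1) (hR : 0 < R)
    (hD : 0 < D) (h : ∀ n : ℕ, ∃ S : Finset ℝ,
      (∀ a ∈ A, ∃ x ∈ S, |a - x| ≤ R * (2 ^ n / (n ! : ℝ))) ∧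
      (S.card : ℝ) ≤ D ^ n * (n ! : ℝ) ^ α) : HasBoxBound A α := fun t ht => by
  have ht0 : 0 < t := by linarith
  set r : ℕ → ℝ := fun n => R * (2 ^ n / (n ! : ℝ)) with hr
  have hr0 : ∀ n, 0 < r n := fun n => by positivity
  have hrlim : Tendsto r atTop (𝓝 0) := by
    simpa using (FloorSemiring.tendsto_pow_div_factorial_atTop (2 : ℝ)).const_mul R
  obtain ⟨N, hN⟩ := eventually_atTop.1 (eventually_mul_pow_mul_factorial_rpow_le ht (D * R ^ t)
    (D := D * 2 * 2 ^ t) (by positivity))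
  have hsmall : ∀ᶠ ε in 𝓝[>] (0 : ℝ), ∀ m ∈ Finset.range (N + 1), ε < r m := by
    rw [Filter.eventually_all_finset]
    exact fun m _ => (gt_mem_nhds (hr0 m)).filter_mono nhdsWithin_le_nhds
  filter_upwards [hsmall, self_mem_nhdsWithin] with ε hε hε0
  have hε0 : 0 < ε := hε0
  have hex : ∃ n, r n ≤ ε := ((hrlim.eventually_lt_const hε0).mono fun _ h => h.le).exists
  classical
  -- The first scale below `ε`; the cover is taken at scale `n = m + 1`, while `ε` is compared with
  -- the previous scale `r m`.
  obtain ⟨n, hn, hmin⟩ : ∃ n, r n ≤ ε ∧ ∀ m < n, ε < r m :=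
    ⟨Nat.find hex, Nat.find_spec hex, fun m hm => not_le.1 (Nat.find_min hex hm)⟩
  have hNn : N < n := by
    by_contra! hcon
    exact (hε n (Finset.mem_range.2 (by omega))).not_ge hn
  obtain ⟨m, rfl⟩ : ∃ m, n = m + 1 := ⟨n - 1, by omega⟩
  obtain ⟨S, hS, hSc⟩ := h (m + 1)
  refine ⟨S, fun a ha => ?_, hSc.trans ?_⟩
  · obtain ⟨x, hx, hax⟩ := hS a ha
    exact ⟨x, hx, hax.trans hn⟩
  have hm := hN m (by omega)
  have hεm : ε ≤ r m := (hmin m (by omega)).le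
  have hm0 : (0 : ℝ) < (m ! : ℝ) := by exact_mod_cast m.factorial_pos
  have h3 : (r m) ^ t = R ^ t * ((2 ^ t) ^ m / (m ! : ℝ) ^ t) := by
    rw [hr]
    simp only
    rw [Real.mul_rpow hR.le (by positivity), Real.div_rpow (by positivity) hm0.le]
    congr 2
    rw [← Real.rpow_natCast, ← Real.rpow_natCast, ← Real.rpow_mul (by norm_num),
      ← Real.rpow_mul (by norm_num), mul_comm]
  rw [Real.rpow_neg hε0.le, ← one_div, le_div_iff₀ (by positivity)]
  have h4 : ((m + 1)! : ℝ) ^ α ≤ 2 ^ m * (m ! : ℝ) ^ α := by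
    rw [Nat.factorial_succ]
    push_cast
    rw [Real.mul_rpow (by positivity) (by positivity)]
    gcongr
    exact natCast_add_one_rpow_le_two_pow h1 m
  calc D ^ (m + 1) * ((m + 1)! : ℝ) ^ α * ε ^ t
      ≤ D ^ (m + 1) * (2 ^ m * (m ! : ℝ) ^ α) * (r m) ^ t := by gcongr
    _ = (D * R ^ t * (D * 2 * 2 ^ t) ^ m * (m ! : ℝ) ^ α) / (m ! : ℝ) ^ t := by
        rw [h3, mul_pow, mul_pow, pow_succ]; ring
    _ ≤ 1 := (div_le_one (by positivity)).2 hm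

theorem tsum_two_pow_div_factorial_add_le (n : ℕ) :
    ∑' i, (2 : ℝ) ^ (i + n) / ((i + n)! : ℝ) ≤
      (∑' i, (2 : ℝ) ^ i / (i ! : ℝ)) * (2 ^ n / (n ! : ℝ)) := by
  rw [← tsum_mul_right]
  refine Summable.tsum_le_tsum (fun i => ?_)
    ((summable_nat_add_iff n).2 (Real.summable_pow_div_factorial 2))
    ((Real.summable_pow_div_factorial 2).mul_right _)
  rw [div_mul_div_comm, ← pow_add]
  have h := Nat.le_of_dvd (Nat.factorial_pos _) (Nat.factorial_mul_factorial_dvd_factorial_add i n)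
  gcongr
  exact_mod_cast h

theorem prod_range_max_rpow_le {α : ℝ} (h0 : 0 ≤ α) (n : ℕ) :
    ∏ k ∈ Finset.range n, ((max k 1 : ℕ) : ℝ) ^ α ≤ (n ! : ℝ) ^ α := by
  rw [Real.finsetProd_rpow _ _ (fun i _ => by positivity)]
  refine Real.rpow_le_rpow (Finset.prod_nonneg fun i _ => by positivity) ?_ h0
  rw [← Finset.prod_range_add_one_eq_factorial]
  push_cast
  refine Finset.prod_le_prod (fun i _ => by positivity) fun i _ => ?_
  exact max_le (by linarith) (by linarith [(Nat.cast_nonneg i : (0 : ℝ) ≤ i)])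

/-- Truncation after `n` digits leaves at most `(2κ + 1) ^ n * (n !) ^ α` points and an error of
order `2 ^ n / n !`. The factor `κ + 1` in `R` keeps `R` positive when `κ = 0`. -/
theorem hasBoxBound_erdosVolkmannPiece {α : ℝ} (h0 : 0 ≤ α) (h1 : α ≤ 1) (κ : ℕ) :
    HasBoxBound (erdosVolkmannPiece α κ) α := by
  set E := ∑' i : ℕ, (2 : ℝ) ^ i / (i ! : ℝ) with hE
  have hE0 : 0 < E := (Real.summable_pow_div_factorial 2).tsum_pos (fun i => by positivity) 0
    (by simp)
  refine hasBoxBound_of_factorial (R := (κ + 1) * E) (D := 2 * κ + 1) h0 h1 (by positivity)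
    (by positivity) fun n => ?_
  set b : ℕ → ℤ := fun k => ⌊(κ : ℝ) * ((max k 1 : ℕ) : ℝ) ^ α⌋
  have hb0 : ∀ k, 0 ≤ b k := fun k => Int.floor_nonneg.2 (by positivity)
  set Q : Finset (Fin n → ℤ) := Fintype.piFinset fun k : Fin n => Finset.Icc (-b k) (b k)
  refine ⟨Q.image fun a => ∑ k : Fin n, (a k : ℝ) / ((k : ℕ)! : ℝ), ?_, ?_⟩
  · rintro x ⟨a, ha, hx⟩
    refine ⟨_, Finset.mem_image_of_mem _ (a := fun k : Fin n => a k) ?_, ?_⟩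
    · refine Fintype.mem_piFinset.2 fun k => Finset.mem_Icc.2 ?_
      have := abs_le.1 (ha k)
      refine ⟨?_, Int.le_floor.2 this.2⟩
      rw [neg_le]
      refine Int.le_floor.2 ?_
      rw [Int.cast_neg]
      linarith [this.1]
    · have hx' := (hasSum_nat_add_iff' n).2 hx
      rw [Finset.sum_range] at hx'
      have hs := (summable_nat_add_iff n).2 (summable_two_pow_div_factorial κ)
      have := hx'.norm_le_of_bounded hs.hasSum fun i => norm_div_factorial_le h1 (ha (i + n))
      rw [Real.norm_eq_abs] at this
      refine this.trans ?_
      rw [tsum_mul_left, mul_assoc]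
      gcongr
      · linarith
      · exact tsum_two_pow_div_factorial_add_le n
  · have h2 : ∀ k, ((Finset.Icc (-b k) (b k)).card : ℝ) ≤
        (2 * κ + 1) * ((max k 1 : ℕ) : ℝ) ^ α := by
      intro k
      have h3 : ((Finset.Icc (-b k) (b k)).card : ℝ) = 2 * (b k : ℝ) + 1 := by
        rw [Int.card_Icc]
        have : ((b k + 1 - -b k).toNat : ℤ) = 2 * b k + 1 := by
          rw [Int.toNat_of_nonneg (by linarith [hb0 k])]; ring
        exact_mod_cast this
      have h4 : (b k : ℝ) ≤ (κ : ℝ) * ((max k 1 : ℕ) : ℝ) ^ α := Int.floor_le _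
      have h5 := one_le_max_rpow h0 k
      rw [h3]
      linarith
    calc (((Q.image _).card : ℕ) : ℝ) ≤ (Q.card : ℝ) := by exact_mod_cast Finset.card_image_le
      _ = ∏ k ∈ Finset.range n, ((Finset.Icc (-b k) (b k)).card : ℝ) := by
          rw [Fintype.card_piFinset, Finset.prod_range]; push_cast; rfl
      _ ≤ ∏ k ∈ Finset.range n, ((2 * κ + 1) * ((max k 1 : ℕ) : ℝ) ^ α) :=
          Finset.prod_le_prod (fun _ _ => by positivity) fun k _ => h2 k
      _ ≤ (2 * κ + 1) ^ n * (n ! : ℝ) ^ α := by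
          rw [Finset.prod_mul_distrib, Finset.prod_const, Finset.card_range]
          gcongr
          exact prod_range_max_rpow_le h0 n

/-! ### Lower bound for the Hausdorff dimension of the Erdős–Volkmann groups -/

/-- The inverse of `g` is `s`-Hölder onto an interval of dimension one, and an `s`-Hölder map raises
dimension by a factor of at most `1 / s`. -/
theorem le_dimH_image_of_abs_sub_le {g : ℝ → ℝ} {C s : ℝ≥0} (hs : 0 < s)
    (h : ∀ y ∈ Ico (0 : ℝ) 1, ∀ z ∈ Ico (0 : ℝ) 1, |y - z| ≤ C * |g y - g z| ^ (s : ℝ)) :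
    (s : ℝ≥0∞) ≤ dimH (g '' Ico (0 : ℝ) 1) := by
  have hs' : (0 : ℝ) < s := NNReal.coe_pos.2 hs
  have hinj : InjOn g (Ico (0 : ℝ) 1) := fun y hy z hz hyz => by
    have := h y hy z hz
    rw [hyz, sub_self, abs_zero, Real.zero_rpow hs'.ne', mul_zero] at this
    exact sub_eq_zero.1 (abs_nonpos_iff.1 this)
  set f := Function.invFunOn g (Ico (0 : ℝ) 1)
  have hf : LeftInvOn f g (Ico (0 : ℝ) 1) := hinj.leftInvOn_invFunOn
  have hhol : HolderOnWith C s f (g '' Ico (0 : ℝ) 1) := by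
    rintro _ ⟨y, hy, rfl⟩ _ ⟨z, hz, rfl⟩
    rw [hf hy, hf hz, edist_dist, edist_dist, Real.dist_eq, Real.dist_eq,
      ENNReal.ofReal_rpow_of_nonneg (abs_nonneg _) hs'.le,
      ← ENNReal.ofReal_coe_nnreal, ← ENNReal.ofReal_mul C.coe_nonneg]
    exact ENNReal.ofReal_le_ofReal (h y hy z hz)
  have h1 := hhol.dimH_image_le hs
  rw [hf.image_image] at h1
  have h2 : dimH (Ico (0 : ℝ) 1) = 1 := by
    rw [Real.dimH_of_nonempty_interior (by rw [interior_Ico]; exact nonempty_Ioo.2 zero_lt_one)]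
    simp
  rw [h2, ENNReal.le_div_iff_mul_le (Or.inl (by simpa using hs.ne')) (Or.inl (by simp)),
    one_mul] at h1
  exact h1

/-- Telescoping: `(k - 1) / k ! = 1 / (k - 1)! - 1 / k !`. -/
theorem hasSum_div_two_mul_factorial (n : ℕ) :
    HasSum (fun i : ℕ => ((n + i : ℕ) : ℝ) / 2 / ((i + (n + 1))! : ℝ)) (1 / (2 * (n ! : ℝ))) := by
  have hnn : ∀ i : ℕ, 0 ≤ ((n + i : ℕ) : ℝ) / 2 / ((i + (n + 1))! : ℝ) := fun i => by positivity
  rw [hasSum_iff_tendsto_nat_of_nonneg hnn]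
  have hterm : ∀ i : ℕ, ((n + i : ℕ) : ℝ) / 2 / ((i + (n + 1))! : ℝ) =
      1 / (2 * ((i + n)! : ℝ)) - 1 / (2 * ((i + 1 + n)! : ℝ)) := by
    intro i
    have h1 : i + (n + 1) = (i + n) + 1 := by ring
    have h2 : i + 1 + n = (i + n) + 1 := by ring
    have h0 : ((i + n)! : ℝ) ≠ 0 := by exact_mod_cast (Nat.factorial_pos _).ne'
    rw [h1, h2, Nat.factorial_succ]
    push_cast
    have h3 : ((i : ℝ) + n + 1) ≠ 0 := by positivity
    field_simp
    ring
  simp_rw [hterm]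
  simp_rw [Finset.sum_range_sub' (fun i => 1 / (2 * ((i + n)! : ℝ)))]
  have hlim : Tendsto (fun i : ℕ => 1 / (2 * ((i + n)! : ℝ))) atTop (𝓝 0) := by
    refine tendsto_const_nhds.div_atTop (Tendsto.const_mul_atTop two_pos ?_)
    exact tendsto_natCast_atTop_atTop.comp
      (tendsto_atTop_mono (fun i => (Nat.le_add_right i n).trans (Nat.self_le_factorial _))
        tendsto_id)
  simpa using hlim.const_sub (1 / (2 * ((0 + n)! : ℝ)))

/-- The leading term is at least `1 / n !` in absolute value, and the bound on the digits keeps the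
tail below half of that. -/
theorem le_abs_of_hasSum_div_factorial {d : ℕ → ℤ} {z : ℝ} {n : ℕ} (h0 : ∀ k < n, d k = 0)
    (hn : d n ≠ 0) (hd : ∀ k, |(d (k + 1) : ℝ)| ≤ k / 2)
    (hz : HasSum (fun k => (d k : ℝ) / (k ! : ℝ)) z) : 1 / (2 * (n ! : ℝ)) ≤ |z| := by
  have hz' := (hasSum_nat_add_iff' (n + 1)).2 hz
  rw [Finset.sum_range_succ, Finset.sum_eq_zero (fun k hk => by
    rw [h0 k (Finset.mem_range.1 hk)]; simp), zero_add] at hz'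
  have hb := hz'.norm_le_of_bounded (hasSum_div_two_mul_factorial n) fun i => by
    rw [norm_div, Real.norm_eq_abs, Real.norm_natCast]
    gcongr
    have := hd (i + n)
    rw [add_assoc] at this
    simpa [add_comm] using this
  rw [Real.norm_eq_abs] at hb
  have hfac : (0 : ℝ) < (n ! : ℝ) := by exact_mod_cast n.factorial_pos
  have h1 : 1 / (n ! : ℝ) ≤ |(d n : ℝ) / (n ! : ℝ)| := by
    rw [abs_div, abs_of_pos hfac]
    gcongr
    exact_mod_cast Int.one_le_abs hn
  have h2 : |(d n : ℝ) / (n ! : ℝ)| ≤ |z| + |z - (d n : ℝ) / (n ! : ℝ)| := by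
    rw [abs_sub_comm]
    calc |(d n : ℝ) / (n ! : ℝ)| = |z + ((d n : ℝ) / (n ! : ℝ) - z)| := by ring_nf
      _ ≤ _ := abs_add_le _ _
  have h3 : 1 / (n ! : ℝ) = 2 * (1 / (2 * (n ! : ℝ))) := by field_simp
  linarith

/-- The base of the `k`-th digit in the mixed radix expansions used for `α`. -/
noncomputable def radix (α : ℝ) (k : ℕ) : ℕ := max 1 ⌊(k : ℝ) ^ α / 2⌋₊

/-- The product of the first `n` bases. -/
noncomputable def radixProd (α : ℝ) : ℕ → ℕ
  | 0 => 1
  | n + 1 => radixProd α n * radix α (n + 1)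

/-- The mixed radix digits of `y`. -/
noncomputable def radixDigit (α : ℝ) (y : ℝ) : ℕ → ℤ
  | 0 => 0
  | n + 1 => ⌊(radixProd α (n + 1) : ℝ) * y⌋ - radix α (n + 1) * ⌊(radixProd α n : ℝ) * y⌋

/-- The mixed radix digits of `y`, read in the factorial number system. -/
noncomputable def radixToFactorial (α : ℝ) (y : ℝ) : ℝ :=
  ∑' k, (radixDigit α y k : ℝ) / (k ! : ℝ)

/-- The halving in `radix` yields the first bound, needed to separate digit strings; the second
keeps the digits admissible for `G_α`. -/
theorem radix_sub_one_le {α : ℝ} (k : ℕ) (h1 : α ≤ 1) :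
    (radix α (k + 1) : ℝ) - 1 ≤ k / 2 ∧ (radix α (k + 1) : ℝ) - 1 ≤ ((k + 1 : ℕ) : ℝ) ^ α := by
  have hk : (0 : ℝ) ≤ k := Nat.cast_nonneg k
  have hp : (0 : ℝ) ≤ ((k + 1 : ℕ) : ℝ) ^ α := by positivity
  have hp1 : ((k + 1 : ℕ) : ℝ) ^ α ≤ k + 1 := by
    calc ((k + 1 : ℕ) : ℝ) ^ α ≤ ((k + 1 : ℕ) : ℝ) ^ (1 : ℝ) :=
          Real.rpow_le_rpow_of_exponent_le (by push_cast; linarith) h1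
      _ = k + 1 := by rw [Real.rpow_one]; push_cast; rfl
  have hf : (⌊((k + 1 : ℕ) : ℝ) ^ α / 2⌋₊ : ℝ) ≤ ((k + 1 : ℕ) : ℝ) ^ α / 2 :=
    Nat.floor_le (by positivity)
  have hm : (radix α (k + 1) : ℝ) ≤ max 1 (((k + 1 : ℕ) : ℝ) ^ α / 2) := by
    rw [radix]
    push_cast at hf ⊢
    exact max_le_max le_rfl hf
  rcases le_total 1 (((k + 1 : ℕ) : ℝ) ^ α / 2) with h | h
  · rw [max_eq_right h] at hm
    constructor <;> linarith
  · rw [max_eq_left h] at hm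
    constructor <;> linarith

theorem radixDigit_nonneg (α y : ℝ) (k : ℕ) : 0 ≤ radixDigit α y k := by
  cases k with
  | zero => exact le_rfl
  | succ n =>
    rw [radixDigit, sub_nonneg, Int.le_floor]
    push_cast [radixProd]
    have := Int.floor_le ((radixProd α n : ℝ) * y)
    calc _ ≤ (radix α (n + 1) : ℝ) * ((radixProd α n : ℝ) * y) := by gcongr
      _ = _ := by ring

theorem radixDigit_le (α y : ℝ) (k : ℕ) :
    (radixDigit α y (k + 1) : ℝ) ≤ (radix α (k + 1) : ℝ) - 1 := by
  have hpos : (0 : ℝ) < radix α (k + 1) := by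
    have : 0 < radix α (k + 1) := lt_of_lt_of_le one_pos (le_max_left _ _)
    exact_mod_cast this
  have h : radixDigit α y (k + 1) < (radix α (k + 1) : ℤ) := by
    rw [radixDigit, sub_lt_iff_lt_add, Int.floor_lt]
    push_cast [radixProd]
    have := Int.lt_floor_add_one ((radixProd α k : ℝ) * y)
    calc _ = (radix α (k + 1) : ℝ) * ((radixProd α k : ℝ) * y) := by ring
      _ < (radix α (k + 1) : ℝ) * (⌊(radixProd α k : ℝ) * y⌋ + 1) := by gcongr
      _ = _ := by ring
  have : radixDigit α y (k + 1) ≤ (radix α (k + 1) : ℤ) - 1 := by omega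
  exact_mod_cast this

theorem abs_radixDigit_le {α : ℝ} (h1 : α ≤ 1) (y : ℝ) (k : ℕ) :
    |(radixDigit α y k : ℝ)| ≤ 1 * ((max k 1 : ℕ) : ℝ) ^ α := by
  have h0 : (0 : ℝ) ≤ radixDigit α y k := by exact_mod_cast radixDigit_nonneg α y k
  rw [abs_of_nonneg h0, one_mul]
  cases k with
  | zero => simp [radixDigit]
  | succ k =>
    rw [max_eq_left (by omega)]
    exact (radixDigit_le α y k).trans (radix_sub_one_le k h1).2

theorem hasSum_radixToFactorial {α : ℝ} (h1 : α ≤ 1) (y : ℝ) :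
    HasSum (fun k => (radixDigit α y k : ℝ) / (k ! : ℝ)) (radixToFactorial α y) :=
  (Summable.of_norm_bounded (summable_two_pow_div_factorial (1 : ℕ))
    fun k => norm_div_factorial_le h1 (by simpa using abs_radixDigit_le h1 y k)).hasSum

theorem radixToFactorial_mem {α : ℝ} (h1 : α ≤ 1) (y : ℝ) :
    radixToFactorial α y ∈ erdosVolkmannGroup α := by
  refine ⟨radixDigit α y, ⟨1, 1, fun k hk => ?_⟩, hasSum_radixToFactorial h1 y⟩
  simpa [max_eq_left hk] using abs_radixDigit_le h1 y k

/-- Halving, rounding down and the lower cutoff at `1` cost at most a factor `4` per base. -/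
theorem factorial_rpow_le_radixProd (α : ℝ) (n : ℕ) :
    (n ! : ℝ) ^ α ≤ 4 ^ n * radixProd α n := by
  induction n with
  | zero => simp [radixProd]
  | succ n ih =>
    have h : ((n + 1 : ℕ) : ℝ) ^ α ≤ 4 * radix α (n + 1) := by
      rw [radix]
      have h1 := Nat.lt_floor_add_one (((n + 1 : ℕ) : ℝ) ^ α / 2)
      have h2 : (1 : ℝ) ≤ (max 1 ⌊((n + 1 : ℕ) : ℝ) ^ α / 2⌋₊ : ℕ) := by
        exact_mod_cast le_max_left _ _
      have h3 : (⌊((n + 1 : ℕ) : ℝ) ^ α / 2⌋₊ : ℝ) ≤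
          (max 1 ⌊((n + 1 : ℕ) : ℝ) ^ α / 2⌋₊ : ℕ) := by
        exact_mod_cast le_max_right _ _
      linarith
    rw [Nat.factorial_succ, radixProd, Nat.cast_mul, Real.mul_rpow (by positivity) (by positivity)]
    push_cast at h ⊢
    calc ((n : ℝ) + 1) ^ α * (n ! : ℝ) ^ α
        ≤ (4 * radix α (n + 1)) * (4 ^ n * radixProd α n) := by gcongr
      _ = _ := by ring

theorem radixProd_pos (α : ℝ) (n : ℕ) : (0 : ℝ) < radixProd α n := by
  have : 0 < radixProd α n := by
    induction n with
    | zero => exact one_pos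
    | succ n ih => exact Nat.mul_pos ih (lt_of_lt_of_le one_pos (le_max_left _ _))
  exact_mod_cast this

theorem exists_bound_of_eventually_le {u v : ℕ → ℝ} (hv : ∀ n, 0 < v n)
    (h : ∀ᶠ n in atTop, u n ≤ v n) : ∃ C : ℝ, 0 < C ∧ ∀ n, u n ≤ C * v n := by
  obtain ⟨N, hN⟩ := eventually_atTop.1 h
  have hnn : ∀ i, 0 ≤ |u i| / v i := fun i => div_nonneg (abs_nonneg _) (hv i).le
  have hS := Finset.sum_nonneg (s := Finset.range N) fun i _ => hnn i
  refine ⟨1 + ∑ i ∈ Finset.range N, |u i| / v i, by linarith, fun n => ?_⟩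
  rcases lt_or_ge n N with hn | hn
  · have h1 : |u n| / v n ≤ ∑ i ∈ Finset.range N, |u i| / v i :=
      Finset.single_le_sum (f := fun i => |u i| / v i) (fun i _ => hnn i) (Finset.mem_range.2 hn)
    have h2 := (div_le_iff₀ (hv n)).1 h1
    linarith [le_abs_self (u n), hv n]
  · have := mul_nonneg hS (hv n).le
    linarith [hN n hn]

theorem exists_factorial_rpow_le_radixProd {α s : ℝ} (hsα : s < α)
    (h1 : α ≤ 1) : ∃ C : ℝ, 0 < C ∧ ∀ n : ℕ, (2 * ((n + 1)! : ℝ)) ^ s ≤ C * radixProd α n := by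
  refine exists_bound_of_eventually_le (radixProd_pos α) ?_
  filter_upwards [eventually_mul_pow_mul_factorial_rpow_le hsα (2 ^ s) (D := 8) (by norm_num)]
    with n hn
  have h2 : (2 * ((n + 1)! : ℝ)) ^ s ≤ 2 ^ s * (2 ^ n * (n ! : ℝ) ^ s) := by
    rw [Nat.factorial_succ]
    push_cast
    rw [Real.mul_rpow (by norm_num) (by positivity), Real.mul_rpow (by positivity) (by positivity)]
    gcongr
    exact natCast_add_one_rpow_le_two_pow (hsα.le.trans h1) n
  have h3 := factorial_rpow_le_radixProd α n
  have h4 : (4 : ℝ) ^ n * (2 ^ s * (2 ^ n * (n ! : ℝ) ^ s)) = 2 ^ s * 8 ^ n * (n ! : ℝ) ^ s := by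
    rw [show (8 : ℝ) = 4 * 2 by norm_num, mul_pow]; ring
  have h5 : (4 : ℝ) ^ n * (2 * ((n + 1)! : ℝ)) ^ s ≤ 4 ^ n * radixProd α n :=
    calc _ ≤ (4 : ℝ) ^ n * (2 ^ s * (2 ^ n * (n ! : ℝ) ^ s)) := by gcongr
      _ ≤ _ := by rw [h4]; exact hn.trans h3
  exact le_of_mul_le_mul_left h5 (by positivity)

theorem exists_first_floor_ne {α : ℝ} (hlim : Tendsto (fun n => (radixProd α n : ℝ)) atTop atTop)
    {y z : ℝ} (hy : y ∈ Ico (0 : ℝ) 1) (hz : z ∈ Ico (0 : ℝ) 1) (hyz : y ≠ z) :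
    ∃ n, ⌊(radixProd α (n + 1) : ℝ) * y⌋ ≠ ⌊(radixProd α (n + 1) : ℝ) * z⌋ ∧
      ∀ k ≤ n, ⌊(radixProd α k : ℝ) * y⌋ = ⌊(radixProd α k : ℝ) * z⌋ := by
  classical
  have hex : ∃ n, ⌊(radixProd α n : ℝ) * y⌋ ≠ ⌊(radixProd α n : ℝ) * z⌋ := by
    by_contra! hcon
    have hpos : 0 < |y - z| := abs_pos.2 (sub_ne_zero.2 hyz)
    obtain ⟨n, hn⟩ := (hlim.eventually_ge_atTop (1 / |y - z|)).exists
    have h1 := Int.abs_sub_lt_one_of_floor_eq_floor (hcon n)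
    rw [← mul_sub, abs_mul, abs_of_pos (radixProd_pos α n)] at h1
    rw [div_le_iff₀ hpos] at hn
    linarith
  obtain ⟨n, hn, hmin⟩ : ∃ n, ⌊(radixProd α n : ℝ) * y⌋ ≠ ⌊(radixProd α n : ℝ) * z⌋ ∧
      ∀ m < n, ⌊(radixProd α m : ℝ) * y⌋ = ⌊(radixProd α m : ℝ) * z⌋ :=
    ⟨Nat.find hex, Nat.find_spec hex, fun m hm => not_not.1 (Nat.find_min hex hm)⟩
  cases n with
  | zero =>
    exfalso
    apply hn
    simp only [radixProd, Nat.cast_one, one_mul]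
    rw [Int.floor_eq_zero_iff.2 hy, Int.floor_eq_zero_iff.2 hz]
  | succ n => exact ⟨n, hn, fun k hk => hmin k (by omega)⟩

theorem le_dimH_erdosVolkmannGroup {α : ℝ} (h1 : α ≤ 1) :
    ENNReal.ofReal α ≤ dimH (erdosVolkmannGroup α : Set ℝ) := by
  refine le_of_forall_lt fun b hb => ?_
  obtain ⟨s', hs1, hs2⟩ := ENNReal.lt_iff_exists_nnreal_btwn.1 hb
  refine hs1.trans_le ?_
  rcases eq_or_ne s' 0 with rfl | hs0
  · simp
  have hs : (0 : ℝ) < s' := NNReal.coe_pos.2 (pos_iff_ne_zero.2 hs0)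
  obtain ⟨s, hss⟩ : ∃ s : ℝ, s = s' := ⟨_, rfl⟩
  rw [← hss] at hs
  have hsα : s < α := by
    rw [← ENNReal.ofReal_coe_nnreal, ← hss] at hs2
    exact (ENNReal.ofReal_lt_ofReal_iff_of_nonneg hs.le).1 hs2
  have hα : 0 < α := hs.trans hsα
  obtain ⟨C, hC, hCM⟩ := exists_factorial_rpow_le_radixProd hsα h1
  have hlim : Tendsto (fun n => (radixProd α n : ℝ)) atTop atTop := by
    have h2 : Tendsto (fun n : ℕ => (1 / C) * (n : ℝ) ^ s) atTop atTop :=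
      ((tendsto_rpow_atTop hs).comp tendsto_natCast_atTop_atTop).const_mul_atTop (by positivity)
    refine tendsto_atTop_mono (fun n => ?_) h2
    rw [one_div_mul_eq_div, div_le_iff₀ hC, mul_comm]
    refine le_trans ?_ (hCM n)
    gcongr
    have h3 : (n : ℝ) ≤ ((n + 1)! : ℝ) := by
      exact_mod_cast n.le_succ.trans (Nat.self_le_factorial _)
    linarith [(Nat.cast_nonneg n : (0 : ℝ) ≤ n)]
  have hsub : radixToFactorial α '' Ico (0 : ℝ) 1 ⊆ erdosVolkmannGroup α := by
    rintro _ ⟨y, -, rfl⟩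
    exact radixToFactorial_mem h1 y
  refine le_trans ?_ (dimH_mono hsub)
  lift C to ℝ≥0 using hC.le
  refine le_dimH_image_of_abs_sub_le (C := C) (pos_iff_ne_zero.2 hs0) fun y hy z hz => ?_
  rw [← hss]
  rcases eq_or_ne y z with rfl | hyz
  · simp [Real.zero_rpow hs.ne']
  -- The digits first differ at index `n + 1`: the images are at least `1 / (2 (n + 1)!)` apart,
  -- while `y` and `z` are within `1 / radixProd α n`.
  obtain ⟨n, hn, hk⟩ := exists_first_floor_ne hlim hy hz hyz
  have hsum := (hasSum_radixToFactorial h1 y).sub (hasSum_radixToFactorial h1 z)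
  have hsep : 1 / (2 * ((n + 1)! : ℝ)) ≤ |radixToFactorial α y - radixToFactorial α z| := by
    refine le_abs_of_hasSum_div_factorial (d := fun k => radixDigit α y k - radixDigit α z k)
      (fun k hkn => ?_) ?_ (fun k => ?_) ?_
    · cases k with
      | zero => simp [radixDigit]
      | succ k => simp only [radixDigit]; rw [hk k (by omega), hk (k + 1) (by omega), sub_self]
    · simp only [radixDigit]
      rw [hk n le_rfl]
      intro h
      apply hn
      linarith
    · have hy1 := radixDigit_le α y k
      have hz1 := radixDigit_le α z k
      have hy0 : (0 : ℝ) ≤ radixDigit α y (k + 1) := by exact_mod_cast radixDigit_nonneg α y _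
      have hz0 : (0 : ℝ) ≤ radixDigit α z (k + 1) := by exact_mod_cast radixDigit_nonneg α z _
      have := (radix_sub_one_le k h1).1
      push_cast
      exact abs_le.2 ⟨by linarith, by linarith⟩
    · simpa [sub_div] using hsum
  have hM := radixProd_pos α n
  have h2 := Int.abs_sub_lt_one_of_floor_eq_floor (hk n le_rfl)
  rw [← mul_sub, abs_mul, abs_of_pos hM] at h2
  calc |y - z| ≤ 1 / radixProd α n := by rw [le_div_iff₀ hM]; linarith
    _ ≤ C * (1 / (2 * ((n + 1)! : ℝ))) ^ s := by
        rw [Real.div_rpow zero_le_one (by positivity), Real.one_rpow, mul_one_div,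
          div_le_div_iff₀ hM (by positivity), one_mul]
        exact hCM n
    _ ≤ C * |radixToFactorial α y - radixToFactorial α z| ^ s := by gcongr

theorem packingDim_erdosVolkmannGroup_le {α : ℝ} (h0 : 0 ≤ α) (h1 : α ≤ 1) :
    packingDim (erdosVolkmannGroup α : Set ℝ) ≤ ENNReal.ofReal α :=
  packingDim_le h0 (erdosVolkmannGroup_eq_iUnion h0).subset
    (hasBoxBound_erdosVolkmannPiece h0 h1)

theorem dimH_eq_and_packingDim_eq {A : Set ℝ} {d : ℝ≥0∞} (h1 : d ≤ dimH A)
    (h2 : packingDim A ≤ d) : dimH A = d ∧ packingDim A = d :=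
  ⟨le_antisymm ((dimH_le_packingDim A).trans h2) h1,
    le_antisymm h2 (h1.trans (dimH_le_packingDim A))⟩

theorem volume_erdosVolkmannGroup {α : ℝ} (h0 : 0 ≤ α) (h1 : α < 1) :
    volume (erdosVolkmannGroup α : Set ℝ) = 0 := by
  rw [← hausdorffMeasure_real]
  have : dimH (erdosVolkmannGroup α : Set ℝ) < ((1 : ℝ≥0) : ℝ≥0∞) := by
    refine ((dimH_le_packingDim _).trans (packingDim_erdosVolkmannGroup_le h0 h1.le)).trans_lt ?_
    rw [ENNReal.coe_one, ← ENNReal.ofReal_one]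
    exact (ENNReal.ofReal_lt_ofReal_iff zero_lt_one).2 h1
  simpa using hausdorffMeasure_of_dimH_lt this

/-! ### Typical compact sets -/

/-- The rational span of a countable set is countable, so the sum is a countable union of translates
of `W`. -/
theorem volume_sup_span_eq_zero (W : Submodule ℚ ℝ) (h0 : volume (W : Set ℝ) = 0) {s : Set ℝ}
    (hs : s.Countable) : volume ((W ⊔ Submodule.span ℚ s : Submodule ℚ ℝ) : Set ℝ) = 0 := by
  have := hs.to_subtype
  have hc : Countable (Submodule.span ℚ s) := by
    have : Countable (Submodule.span ℚ (range (Subtype.val : s → ℝ))) := inferInstance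
    rwa [Subtype.range_coe] at this
  refine measure_mono_null (t := ⋃ v : Submodule.span ℚ s, (fun x => x + -(v : ℝ)) ⁻¹' W) ?_
    (measure_iUnion_null fun v => ?_)
  · intro x hx
    obtain ⟨w, hw, v, hv, rfl⟩ := Submodule.mem_sup.1 hx
    refine mem_iUnion.2 ⟨⟨v, hv⟩, ?_⟩
    simpa using hw
  · rw [measure_preimage_add_right, h0]

/-- Finitely many reals can be moved slightly to make them linearly independent modulo `W`. -/
theorem exists_perturbation (W : Submodule ℚ ℝ) (h0 : volume (W : Set ℝ) = 0) (t : Finset ℝ)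
    {δ : ℝ} (hδ : 0 < δ) :
    ∃ f : ℝ → ℝ, (∀ x ∈ t, dist (f x) x < δ) ∧ LinearIndepOn ℚ (W.mkQ ∘ f) (t : Set ℝ) := by
  classical
  induction t using Finset.induction_on with
  | empty => exact ⟨id, by simp, by simp⟩
  | insert a t ha ih =>
    obtain ⟨f, hf, hind⟩ := ih
    obtain ⟨y, hy, hyW⟩ : ∃ y ∈ Metric.ball a δ,
        y ∉ (W ⊔ Submodule.span ℚ (f '' t) : Submodule ℚ ℝ) := by
      by_contra! hcon
      have h1 := measure_mono_null (μ := volume) hcon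
        (volume_sup_span_eq_zero W h0 (t.countable_toSet.image f))
      exact (Metric.measure_ball_pos volume a hδ).ne' h1
    have hne : ∀ x ∈ t, x ≠ a := fun x hx h => ha (h ▸ hx)
    have hEq : EqOn (W.mkQ ∘ f) (W.mkQ ∘ Function.update f a y) (t : Set ℝ) := fun x hx => by
      simp [Function.update_of_ne (hne x hx)]
    refine ⟨Function.update f a y, fun x hx => ?_, ?_⟩
    · rcases Finset.mem_insert.1 hx with rfl | hx
      · simpa using hy
      · rw [Function.update_of_ne (hne x hx)]; exact hf x hx
    · rw [Finset.coe_insert, linearIndepOn_insert (by simpa using ha)]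
      refine ⟨hind.congr hEq, fun hmem => hyW ?_⟩
      rw [← hEq.image_eq, image_comp, Submodule.span_image] at hmem
      rw [← Submodule.comap_map_mkQ, Submodule.mem_comap]
      simpa only [Function.comp_apply, Function.update_self] using hmem

theorem exists_mem_dist_lt {C D : TopologicalSpace.NonemptyCompacts ℝ} {r : ℝ}
    (h : dist C D < r) {x : ℝ} (hx : x ∈ (C : Set ℝ)) : ∃ y ∈ (D : Set ℝ), dist x y < r := by
  rw [Metric.NonemptyCompacts.dist_eq] at h
  exact Metric.exists_dist_lt_of_hausdorffDist_lt hx h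
    (Metric.hausdorffEDist_ne_top_of_nonempty_of_bounded C.nonempty D.nonempty
      C.isCompact.isBounded D.isCompact.isBounded)

/-- The `δ`-separated tuples with sum in `F` form a closed set, and the compact set of tuples from
`C` keeps a positive distance from it. Mere distinctness would not be a closed condition. -/
theorem isOpen_setOf_forall_sum_notMem {n : ℕ} (c : Fin n → ℚ) {F : Set ℝ} (hF : IsClosed F)
    (δ : ℝ) : IsOpen {C : TopologicalSpace.NonemptyCompacts ℝ | ∀ x : Fin n → ℝ,
      (∀ i, x i ∈ (C : Set ℝ)) → (∀ i j, i ≠ j → δ ≤ |x i - x j|) → ∑ i, c i • x i ∉ F} := by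
  rw [Metric.isOpen_iff]
  intro C hC
  have hT : IsClosed {x : Fin n → ℝ | (∀ i j, i ≠ j → δ ≤ |x i - x j|) ∧ ∑ i, c i • x i ∈ F} := by
    refine IsClosed.inter (s₁ := {x : Fin n → ℝ | ∀ i j, i ≠ j → δ ≤ |x i - x j|}) ?_ ?_
    · simp only [ofPred_forall]
      exact isClosed_iInter fun i => isClosed_iInter fun j => isClosed_iInter fun _ =>
        isClosed_le continuous_const (by fun_prop)
    · refine hF.preimage (f := fun x : Fin n → ℝ => ∑ i, c i • x i) ?_
      simp only [Rat.smul_def]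
      fun_prop
  obtain ⟨r, hr, hsub⟩ := (isCompact_univ_pi fun _ : Fin n => C.isCompact).exists_thickening_subset_open
    hT.isOpen_compl (by
      intro x hx ⟨h1, h2⟩
      exact hC x (fun i => hx i (mem_univ i)) h1 h2)
  refine ⟨r, hr, fun D hD x hx hsep hmem => ?_⟩
  choose y hy hxy using fun i => exists_mem_dist_lt (Metric.mem_ball.1 hD) (hx i)
  refine hsub (Metric.mem_thickening_iff.2 ⟨y, fun i _ => hy i, ?_⟩) ⟨hsep, hmem⟩
  exact (dist_pi_lt_iff hr).2 hxy

/-- The finite sets that are linearly independent modulo a null space `W` are dense. -/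
theorem exists_linearIndepOn_near (W : Submodule ℚ ℝ) (h0 : volume (W : Set ℝ) = 0)
    (C : TopologicalSpace.NonemptyCompacts ℝ) {ε : ℝ} (hε : 0 < ε) :
    ∃ D ∈ Metric.ball C ε, LinearIndepOn ℚ W.mkQ (D : Set ℝ) := by
  obtain ⟨t, htC, htfin, hCt⟩ := C.isCompact.finite_cover_balls (show 0 < ε / 4 by linarith)
  lift t to Finset ℝ using htfin
  obtain ⟨f, hf, hind⟩ := exists_perturbation W h0 t (show 0 < ε / 4 by linarith)
  have hne : (f '' t).Nonempty := by
    obtain ⟨x, hx⟩ := C.nonempty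
    obtain ⟨y, hy, -⟩ := mem_iUnion₂.1 (hCt hx)
    exact ⟨f y, mem_image_of_mem f hy⟩
  refine ⟨⟨⟨f '' t, (t.finite_toSet.image f).isCompact⟩, hne⟩, ?_, hind.image_of_comp⟩
  rw [Metric.mem_ball, dist_comm, Metric.NonemptyCompacts.dist_eq]
  refine lt_of_le_of_lt (Metric.hausdorffDist_le_of_mem_dist (r := ε / 2) (by linarith) ?_ ?_)
    (by linarith)
  · intro x hx
    obtain ⟨y, hy, hxy⟩ := mem_iUnion₂.1 (hCt hx)
    refine ⟨f y, mem_image_of_mem f hy, ?_⟩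
    have h1 := dist_triangle x y (f y)
    have h2 := hf y hy
    rw [dist_comm] at h2
    rw [Metric.mem_ball] at hxy
    linarith
  · rintro _ ⟨y, hy, rfl⟩
    exact ⟨y, htC hy, by linarith [hf y hy]⟩

/-- Independence modulo `W` is a countable intersection of open conditions, indexed by the
coefficients, a closed piece of `W` and a separation `1 / (k + 1)`. Each is dense because finite
independent sets are. -/
theorem eventually_residual_linearIndepOn (W : Submodule ℚ ℝ) (hF : IsFSigmaSet (W : Set ℝ))
    (h0 : volume (W : Set ℝ) = 0) :
    ∀ᶠ C : TopologicalSpace.NonemptyCompacts ℝ in residual (TopologicalSpace.NonemptyCompacts ℝ),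
      LinearIndepOn ℚ W.mkQ (C : Set ℝ) := by
  obtain ⟨F, hFc, hWF⟩ := hF
  have hev : ∀ᶠ C : TopologicalSpace.NonemptyCompacts ℝ in residual (TopologicalSpace.NonemptyCompacts ℝ), ∀ (n : ℕ)
      (c : {c : Fin n → ℚ // c ≠ 0}) (j k : ℕ), ∀ x : Fin n → ℝ, (∀ i, x i ∈ (C : Set ℝ)) →
      (∀ i j, i ≠ j → 1 / ((k : ℝ) + 1) ≤ |x i - x j|) → ∑ i, c.1 i • x i ∉ F j := by
    simp only [eventually_countable_forall]
    intro n c j k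
    refine residual_of_dense_open (isOpen_setOf_forall_sum_notMem c.1 (hFc j) _) ?_
    rw [Metric.dense_iff]
    intro C ε hε
    obtain ⟨D, hD, hind⟩ := exists_linearIndepOn_near W h0 C hε
    refine ⟨D, hD, fun x hx hsep hmem => c.2 ?_⟩
    have hinj : Function.Injective fun i => (⟨x i, hx i⟩ : (D : Set ℝ)) := fun i i' h => by
      by_contra hne
      have h1 := hsep i i' hne
      rw [Subtype.mk.inj h, sub_self, abs_zero] at h1
      exact absurd h1 (not_le.2 (by positivity))
    have hli := LinearIndependent.comp hind _ hinj
    rw [Fintype.linearIndependent_iff] at hli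
    refine funext (hli c.1 ?_)
    have h2 : ∑ i, c.1 i • x i ∈ (W : Set ℝ) := hWF ▸ mem_iUnion.2 ⟨j, hmem⟩
    have h3 := (Submodule.Quotient.mk_eq_zero W).2 h2
    rw [← Submodule.mkQ_apply, map_sum] at h3
    simpa using h3
  filter_upwards [hev] with C hC
  rw [LinearIndepOn, linearIndependent_iff']
  intro s g hg
  by_contra! hcon
  obtain ⟨i₀, hi₀, hgi₀⟩ := hcon
  let e := s.equivFin.symm
  set x : Fin s.card → ℝ := fun i => ((e i : (C : Set ℝ)) : ℝ) with hx
  have hinj : Function.Injective x :=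
    Subtype.val_injective.comp (Subtype.val_injective.comp e.injective)
  obtain ⟨k, hk⟩ : ∃ k : ℕ, ∀ i j, i ≠ j → 1 / ((k : ℝ) + 1) ≤ |x i - x j| := by
    have : ∀ᶠ k : ℕ in atTop, ∀ i j, i ≠ j → 1 / ((k : ℝ) + 1) ≤ |x i - x j| := by
      refine eventually_all.2 fun i => eventually_all.2 fun j => ?_
      by_cases hij : i = j
      · simp [hij]
      · have hpos : 0 < |x i - x j| := abs_pos.2 (sub_ne_zero.2 fun h => hij (hinj h))
        filter_upwards [tendsto_one_div_add_atTop_nhds_zero_nat.eventually_le_const hpos]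
          with k hk _
        exact hk
    exact this.exists
  have hsum : ∑ i, g (e i) • x i ∈ (W : Set ℝ) := by
    have h1 : ∑ i ∈ s, g i • (i : ℝ) = ∑ i, g (e i) • x i := by
      rw [← Finset.sum_coe_sort s (fun i => g i • (i : ℝ))]
      exact (Equiv.sum_comp e fun i : s => g i • ((i : (C : Set ℝ)) : ℝ)).symm
    rw [← h1]
    refine (Submodule.Quotient.mk_eq_zero W).1 ?_
    rw [← Submodule.mkQ_apply, map_sum]
    simpa using hg
  rw [hWF] at hsum
  obtain ⟨j, hj⟩ := mem_iUnion.1 hsum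
  refine hC s.card ⟨fun i => g (e i), fun h => hgi₀ ?_⟩ j k x (fun i => (e i : (C : Set ℝ)).2) hk hj
  have := congrFun h (e.symm ⟨i₀, hi₀⟩)
  simpa using this

/-- The typical compact set has no isolated points. -/
theorem eventually_residual_forall_exists_ne :
    ∀ᶠ C : TopologicalSpace.NonemptyCompacts ℝ in residual (TopologicalSpace.NonemptyCompacts ℝ), ∀ n : ℕ, ∀ x ∈ (C : Set ℝ),
      ∃ y ∈ (C : Set ℝ), y ≠ x ∧ dist x y < 1 / ((n : ℝ) + 1) := by
  rw [eventually_countable_forall]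
  intro n
  refine mem_of_superset (residual_of_dense_open (isOpen_interior (s :=
    {C : TopologicalSpace.NonemptyCompacts ℝ | ∀ x ∈ (C : Set ℝ),
      ∃ y ∈ (C : Set ℝ), y ≠ x ∧ dist x y < 1 / ((n : ℝ) + 1)})) ?_) interior_subset
  rw [Metric.dense_iff]
  intro C ε hε
  have hn : (0 : ℝ) < 1 / ((n : ℝ) + 1) := by positivity
  obtain ⟨δ, hδ, hδ2⟩ : ∃ δ, 0 < δ ∧ 2 * δ < min ε (1 / ((n : ℝ) + 1)) :=
    ⟨min ε (1 / ((n : ℝ) + 1)) / 4, by positivity, by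
      linarith [(lt_min hε hn : 0 < min ε (1 / ((n : ℝ) + 1)))]⟩
  have hδε := hδ2.trans_le (min_le_left _ _)
  have hδn := hδ2.trans_le (min_le_right _ _)
  -- Every point of `C ∪ (C + δ)` has a partner at distance exactly `δ`; a perturbation by less than
  -- `δ / 4` keeps the partners distinct and closer than `2 * δ`.
  let D : TopologicalSpace.NonemptyCompacts ℝ :=
    ⟨⟨C ∪ (fun x => x + δ) '' C, C.isCompact.union (C.isCompact.image (by fun_prop))⟩,
      C.nonempty.inl⟩
  have hD : ∀ x ∈ (D : Set ℝ), ∃ y ∈ (D : Set ℝ), dist x y = δ := by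
    rintro x (hx | ⟨y, hy, rfl⟩)
    · exact ⟨x + δ, Or.inr ⟨x, hx, rfl⟩, by simp [abs_of_pos hδ]⟩
    · exact ⟨y, Or.inl hy, by simp [abs_of_pos hδ]⟩
  refine ⟨D, ?_, mem_interior_iff_mem_nhds.2 (mem_of_superset
    (Metric.ball_mem_nhds D (show 0 < δ / 4 by linarith)) ?_)⟩
  · rw [Metric.mem_ball, dist_comm, Metric.NonemptyCompacts.dist_eq]
    refine lt_of_le_of_lt (Metric.hausdorffDist_le_of_mem_dist hδ.le ?_ ?_) (by linarith)
    · exact fun x hx => ⟨x, Or.inl hx, by simpa using hδ.le⟩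
    · rintro x (hx | ⟨y, hy, rfl⟩)
      · exact ⟨x, hx, by simpa using hδ.le⟩
      · exact ⟨y, hy, by simp [abs_of_pos hδ]⟩
  · intro E hE x hx
    rw [Metric.mem_ball] at hE
    obtain ⟨s, hs, hxs⟩ := exists_mem_dist_lt hE hx
    obtain ⟨t, ht, hst⟩ := hD s hs
    obtain ⟨y, hy, hty⟩ := exists_mem_dist_lt (dist_comm E D ▸ hE) ht
    have h1 := dist_triangle4 x s t y
    refine ⟨y, hy, fun hyx => ?_, by linarith⟩
    have h2 := dist_triangle s x t
    rw [dist_comm s x, dist_comm x t, ← hyx] at h2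
    rw [hyx] at h2 hty
    linarith

/-! ### The rational vector space spanned by the Erdős–Volkmann groups -/

/-- The rational vector space spanned by all the groups `G α` with `α < 1`. -/
def erdosVolkmannSpan : Submodule ℚ ℝ where
  carrier := {x | ∃ n N : ℕ, N ≠ 0 ∧ (N : ℝ) * x ∈ erdosVolkmannGroup (1 - 1 / ((n : ℝ) + 1))}
  zero_mem' := ⟨0, 1, one_ne_zero, by simp [zero_mem]⟩
  add_mem' := by
    rintro x y ⟨n, N, hN, hx⟩ ⟨m, M, hM, hy⟩
    have hmono : ∀ k l : ℕ, erdosVolkmannGroup (1 - 1 / ((k : ℝ) + 1)) ≤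
        erdosVolkmannGroup (1 - 1 / (((k + l : ℕ) : ℝ) + 1)) := fun k l => by
      refine erdosVolkmannGroup_mono ?_
      push_cast
      gcongr
      linarith [(Nat.cast_nonneg l : (0 : ℝ) ≤ l)]
    refine ⟨n + m, N * M, mul_ne_zero hN hM, ?_⟩
    have h1 := AddSubgroup.nsmul_mem _ (hmono n m hx) M
    have h2 := AddSubgroup.nsmul_mem _ (hmono m n hy) N
    rw [add_comm m n] at h2
    have h3 := AddSubgroup.add_mem _ h1 h2
    simp only [nsmul_eq_mul] at h3
    convert h3 using 1
    push_cast
    ring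
  smul_mem' := by
    rintro q x ⟨n, N, hN, hx⟩
    refine ⟨n, q.den * N, mul_ne_zero q.den_nz hN, ?_⟩
    have h1 := AddSubgroup.zsmul_mem _ hx q.num
    have h2 : (q : ℝ) * q.den = q.num := by exact_mod_cast Rat.mul_den_eq_num q
    convert h1 using 1
    rw [zsmul_eq_mul, ← h2, Rat.smul_def]
    push_cast
    ring

theorem erdosVolkmannGroup_le_span {α : ℝ} (h1 : α < 1) :
    (erdosVolkmannGroup α : Set ℝ) ⊆ erdosVolkmannSpan := by
  intro x hx
  obtain ⟨n, hn⟩ := exists_nat_one_div_lt (show 0 < 1 - α by linarith)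
  exact ⟨n, 1, one_ne_zero, by
    rw [Nat.cast_one, one_mul]; exact erdosVolkmannGroup_mono (by linarith) hx⟩

theorem one_sub_one_div_mem (n : ℕ) :
    0 ≤ 1 - 1 / ((n : ℝ) + 1) ∧ 1 - 1 / ((n : ℝ) + 1) < 1 := by
  have h : (0 : ℝ) < 1 / ((n : ℝ) + 1) := by positivity
  have h2 : 1 / ((n : ℝ) + 1) ≤ 1 := by
    rw [div_le_one (by positivity)]; linarith [(Nat.cast_nonneg n : (0 : ℝ) ≤ n)]
  constructor <;> linarith

theorem erdosVolkmannSpan_eq_iUnion :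
    (erdosVolkmannSpan : Set ℝ) = ⋃ p : ℕ × ℕ, (fun x => ((p.2 + 1 : ℕ) : ℝ) * x) ⁻¹'
      (erdosVolkmannGroup (1 - 1 / ((p.1 : ℝ) + 1))) := by
  ext x
  simp only [mem_iUnion, mem_preimage, Prod.exists]
  constructor
  · rintro ⟨n, N, hN, hx⟩
    exact ⟨n, N - 1, by rwa [Nat.sub_add_cancel (Nat.one_le_iff_ne_zero.2 hN)]⟩
  · rintro ⟨n, N, hx⟩
    exact ⟨n, N + 1, N.succ_ne_zero, hx⟩

theorem isFSigmaSet_erdosVolkmannSpan : IsFSigmaSet (erdosVolkmannSpan : Set ℝ) := by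
  have h : ∀ p : ℕ × ℕ, IsFSigmaSet ((fun x => ((p.2 + 1 : ℕ) : ℝ) * x) ⁻¹'
      (erdosVolkmannGroup (1 - 1 / ((p.1 : ℝ) + 1)) : Set ℝ)) := fun p =>
    (isFSigmaSet_erdosVolkmannGroup (one_sub_one_div_mem p.1).1
      (one_sub_one_div_mem p.1).2.le).preimage (by fun_prop)
  choose F hF hFe using h
  rw [erdosVolkmannSpan_eq_iUnion]
  simp_rw [hFe]
  rw [← iUnion_prod' fun q : (ℕ × ℕ) × ℕ => F q.1 q.2]
  exact isFSigmaSet_iUnion fun q : (ℕ × ℕ) × ℕ => hF q.1 q.2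

theorem volume_erdosVolkmannSpan : volume (erdosVolkmannSpan : Set ℝ) = 0 := by
  rw [erdosVolkmannSpan_eq_iUnion]
  refine measure_iUnion_null fun p => ?_
  rw [Real.volume_preimage_mul_left (by positivity), volume_erdosVolkmannGroup
    (one_sub_one_div_mem p.1).1 (one_sub_one_div_mem p.1).2, mul_zero]

/-! ### Cantor sets -/

section Brouwer

variable {X : Type*} [TopologicalSpace X]

theorem exists_isClopen_mem_notMem [CompactSpace X] [T2Space X] [TotallyDisconnectedSpace X]
    {p q : X} (h : p ≠ q) : ∃ V : Set X, IsClopen V ∧ p ∈ V ∧ q ∉ V := by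
  obtain ⟨V, hV, hp, hsub⟩ := compact_exists_isClopen_in_isOpen (isOpen_compl_singleton (x := q))
    (show p ∈ ({q} : Set X)ᶜ from h)
  exact ⟨V, hV, hp, fun hq => hsub hq rfl⟩

/-- A nonempty clopen subset of a perfect space splits into two nonempty clopen pieces, each of
which is contained in a given clopen set `V` or in its complement. -/
theorem exists_clopen_split [CompactSpace X] [T2Space X] [TotallyDisconnectedSpace X]
    (hX : ∀ x : X, ∀ U : Set X, IsOpen U → x ∈ U → ∃ y ∈ U, y ≠ x) {A V : Set X}
    (hA : IsClopen A ∧ A.Nonempty) (hV : IsClopen V) :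
    ∃ B : Bool → {A : Set X // IsClopen A ∧ A.Nonempty},
      ((B true : Set X) ∪ B false = A) ∧ Disjoint (B true : Set X) (B false) ∧
      ∀ b, (B b : Set X) ⊆ V ∨ (B b : Set X) ⊆ Vᶜ := by
  by_cases h : (A ∩ V).Nonempty ∧ (A ∩ Vᶜ).Nonempty
  · refine ⟨fun b => bif b then ⟨A ∩ V, hA.1.inter hV, h.1⟩ else ⟨A ∩ Vᶜ, hA.1.inter hV.compl, h.2⟩,
      inter_union_compl A V, ?_, ?_⟩
    · exact (disjoint_compl_right).mono inter_subset_right inter_subset_right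
    · rintro (_ | _)
      · exact Or.inr inter_subset_right
      · exact Or.inl inter_subset_right
  · have hAV : A ⊆ V ∨ A ⊆ Vᶜ := by
      by_contra! hcon
      refine h ⟨?_, ?_⟩
      · obtain ⟨x, hx, hxV⟩ := not_subset.1 hcon.2
        exact ⟨x, hx, not_not.1 hxV⟩
      · obtain ⟨x, hx, hxV⟩ := not_subset.1 hcon.1
        exact ⟨x, hx, hxV⟩
    -- If `V` does not cut `A`, perfectness gives two points of `A`, and any clopen set separating
    -- them may be used for the splitting.
    obtain ⟨p, hp⟩ := hA.2
    obtain ⟨q, hq, hqp⟩ := hX p A hA.1.isOpen hp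
    obtain ⟨U, hU, hqU, hpU⟩ := exists_isClopen_mem_notMem hqp
    refine ⟨fun b => bif b then ⟨A ∩ U, hA.1.inter hU, q, hq, hqU⟩
      else ⟨A ∩ Uᶜ, hA.1.inter hU.compl, p, hp, hpU⟩, inter_union_compl A U, ?_, ?_⟩
    · exact (disjoint_compl_right).mono inter_subset_right inter_subset_right
    · rintro (_ | _)
      · exact hAV.imp inter_subset_left.trans inter_subset_left.trans
      · exact hAV.imp inter_subset_left.trans inter_subset_left.trans

/-- Brouwer's characterization of the Cantor space. -/
theorem nonempty_homeomorph_nat_bool [CompactSpace X] [T2Space X] [TotallyDisconnectedSpace X]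
    [SecondCountableTopology X] [Nonempty X]
    (hX : ∀ x : X, ∀ U : Set X, IsOpen U → x ∈ U → ∃ y ∈ U, y ≠ x) :
    Nonempty ((ℕ → Bool) ≃ₜ X) := by
  classical
  have : Countable (TopologicalSpace.Clopens X) :=
    TopologicalSpace.Clopens.countable_iff_secondCountable.2 inferInstance
  obtain ⟨U, hU⟩ := exists_surjective_nat (TopologicalSpace.Clopens X)
  have hUs : ∀ V : Set X, IsClopen V → ∃ n, (U n : Set X) = V := fun V hV => by
    obtain ⟨n, hn⟩ := hU ⟨V, hV⟩
    exact ⟨n, by rw [hn]; rfl⟩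
  choose S hSu hSd hSV using fun (A : {A : Set X // IsClopen A ∧ A.Nonempty}) (n : ℕ) =>
    exists_clopen_split hX A.2 (U n).isClopen
  let node : (ℕ → Bool) → ℕ → {A : Set X // IsClopen A ∧ A.Nonempty} := fun x n =>
    Nat.rec ⟨univ, isClopen_univ, univ_nonempty⟩ (fun n A => S A n (x n)) n
  have hnode : ∀ x n, node x (n + 1) = S (node x n) n (x n) := fun _ _ => rfl
  have hsub : ∀ A n b, (S A n b : Set X) ⊆ A := fun A n b => by
    rw [← hSu A n]
    cases b
    · exact subset_union_right
    · exact subset_union_left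
  have hcongr : ∀ x y n, (∀ k < n, x k = y k) → node x n = node y n := fun x y n => by
    induction n with
    | zero => exact fun _ => rfl
    | succ n ih =>
      intro h
      rw [hnode, hnode, ih fun k hk => h k (by omega), h n (by omega)]
  have hne : ∀ x, (⋂ n : ℕ, Subtype.val (node x n)).Nonempty := fun x =>
    IsCompact.nonempty_iInter_of_sequence_nonempty_isCompact_isClosed
      (fun n => Subtype.val (node x n)) (fun n => hsub (node x n) n (x n)) (fun n => (node x n).2.2)
      (node x 0).2.1.isClosed.isCompact (fun n => (node x n).2.1.isClosed)
  choose F hF using hne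
  have hFn : ∀ x n, F x ∈ Subtype.val (node x n) := fun x n => mem_iInter.1 (hF x) n
  -- Level `n` of the tree decides the clopen set `U n`, and the `U n` exhaust all clopen sets, so
  -- each branch shrinks to a single point.
  have hdec : ∀ x V, IsClopen V → F x ∈ V → ∃ n, Subtype.val (node x n) ⊆ V := by
    intro x V hV hxV
    obtain ⟨n, rfl⟩ := hUs V hV
    refine ⟨n + 1, (hSV (node x n) n (x n)).resolve_right fun h => ?_⟩
    exact h (hFn x (n + 1)) hxV
  have huniq : ∀ x p, (∀ n, p ∈ Subtype.val (node x n)) → F x = p := by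
    intro x p hp
    by_contra hne
    obtain ⟨V, hV, hxV, hpV⟩ := exists_isClopen_mem_notMem hne
    obtain ⟨n, hn⟩ := hdec x V hV hxV
    exact hpV (hn (hp n))
  have hcont : Continuous F := by
    rw [continuous_iff_continuousAt]
    intro x
    rw [ContinuousAt, (nhds_basis_clopen (F x)).tendsto_right_iff]
    rintro V ⟨hxV, hV⟩
    obtain ⟨n, hn⟩ := hdec x V hV hxV
    have hev : ∀ᶠ y in 𝓝 x, ∀ k ∈ Finset.range n, y k = x k := by
      rw [Filter.eventually_all_finset]
      intro k _
      exact (continuous_apply k).continuousAt.eventually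
        ((isOpen_discrete {x k}).mem_nhds rfl)
    filter_upwards [hev] with y hy
    apply hn
    rw [← hcongr y x n fun k hk => hy k (Finset.mem_range.2 hk)]
    exact hFn y n
  have hinj : Function.Injective F := by
    intro x y hxy
    by_contra hne
    have hex : ∃ n, x n ≠ y n := Function.ne_iff.1 hne
    have hn := Nat.find_spec hex
    have heq := hcongr x y (Nat.find hex) fun k hk => not_not.1 (Nat.find_min hex hk)
    have h1 := hFn x (Nat.find hex + 1)
    have h2 := hFn y (Nat.find hex + 1)
    rw [hnode] at h1 h2
    rw [← heq, ← hxy] at h2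
    have hd := hSd (node x (Nat.find hex)) (Nat.find hex)
    rcases hb : x (Nat.find hex) with _ | _ <;> rcases hc : y (Nat.find hex) with _ | _ <;>
      rw [hb, hc] at hn <;> rw [hb] at h1 <;> rw [hc] at h2
    · exact hn rfl
    · exact disjoint_left.1 hd h2 h1
    · exact disjoint_left.1 hd h1 h2
    · exact hn rfl
  have hsurj : Function.Surjective F := by
    intro p
    let nd : ℕ → {A : Set X // IsClopen A ∧ A.Nonempty} := fun n =>
      Nat.rec ⟨univ, isClopen_univ, univ_nonempty⟩
        (fun n A => S A n (decide (p ∈ (S A n true : Set X)))) n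
    let x : ℕ → Bool := fun n => decide (p ∈ (S (nd n) n true : Set X))
    have hx : ∀ n, node x n = nd n := fun n => by
      induction n with
      | zero => rfl
      | succ n ih => rw [hnode, ih]
    have hp : ∀ n, p ∈ Subtype.val (nd n) := fun n => by
      induction n with
      | zero => exact mem_univ p
      | succ n ih =>
        change p ∈ (S (nd n) n (decide (p ∈ (S (nd n) n true : Set X))) : Set X)
        by_cases h : p ∈ (S (nd n) n true : Set X)
        · rwa [decide_eq_true h]
        · rw [decide_eq_false h]
          rw [← hSu (nd n) n] at ih
          exact ih.resolve_left h
    exact ⟨x, huniq x p fun n => by rw [hx]; exact hp n⟩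
  exact ⟨hcont.homeoOfEquivCompactToT2 (f := Equiv.ofBijective F ⟨hinj, hsurj⟩)⟩

end Brouwer

/-- A nontrivial connected subset would contain two points together with their midpoint, a rational
dependence. -/
theorem isTotallyDisconnected_of_linearIndepOn {C : Set ℝ} (h : LinearIndepOn ℚ id C) :
    IsTotallyDisconnected C := by
  have key : ∀ t ⊆ C, IsPreconnected t → ∀ x ∈ t, ∀ y ∈ t, ¬ x < y := by
    intro t htC ht x hx y hy hxy
    have hm : (x + y) / 2 ∈ C := htC (ht.Icc_subset hx hy ⟨by linarith, by linarith⟩)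
    refine linearIndepOn_iff_notMem_span.1 h _ hm ?_
    have h1 : x ∈ Submodule.span ℚ (id '' (C \ {(x + y) / 2})) :=
      Submodule.subset_span ⟨x, ⟨htC hx, fun h => by rw [mem_singleton_iff] at h; linarith⟩, rfl⟩
    have h2 : y ∈ Submodule.span ℚ (id '' (C \ {(x + y) / 2})) :=
      Submodule.subset_span ⟨y, ⟨htC hy, fun h => by rw [mem_singleton_iff] at h; linarith⟩, rfl⟩
    have h3 := Submodule.smul_mem _ (1 / 2 : ℚ) (Submodule.add_mem _ h1 h2)
    convert h3 using 1
    rw [Rat.smul_def]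
    push_cast
    simp only [id]
    ring
  intro t htC ht x hx y hy
  exact le_antisymm (not_lt.1 (key t htC ht y hy x hx)) (not_lt.1 (key t htC ht x hx y hy))

theorem nonempty_homeomorph_nat_bool_of_linearIndepOn {C : Set ℝ} (hC : IsCompact C)
    (hne : C.Nonempty) (h : LinearIndepOn ℚ id C)
    (hperf : ∀ n : ℕ, ∀ x ∈ C, ∃ y ∈ C, y ≠ x ∧ dist x y < 1 / ((n : ℝ) + 1)) :
    Nonempty ((ℕ → Bool) ≃ₜ C) := by
  have := isCompact_iff_compactSpace.1 hC
  have := hne.to_subtype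
  have : TotallyDisconnectedSpace C :=
    totallyDisconnectedSpace_subtype_iff.2 (isTotallyDisconnected_of_linearIndepOn h)
  refine nonempty_homeomorph_nat_bool fun x U hU hx => ?_
  obtain ⟨ε, hε, hball⟩ := Metric.isOpen_iff.1 hU x hx
  obtain ⟨n, hn⟩ := exists_nat_one_div_lt hε
  obtain ⟨y, hy, hyx, hd⟩ := hperf n x x.2
  refine ⟨⟨y, hy⟩, hball ?_, fun h => hyx (congrArg Subtype.val h)⟩
  rw [Metric.mem_ball, dist_comm]
  exact hd.trans hn

theorem isCantorSpace_of_homeomorph {C : Set ℝ} (e : (ℕ → Bool) ≃ₜ C) : IsCantorSpace C :=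
  ⟨e.symm.trans cantorSetHomeomorphNatToBool.symm⟩

theorem exists_modulus {f : (ℕ → Bool) → ℝ} (hf : Continuous f) {δ : ℝ} (hδ : 0 < δ) :
    ∃ N : ℕ, ∀ x y : ℕ → Bool, (∀ k < N, x k = y k) → |f x - f y| ≤ δ := by
  let m : MetricSpace (ℕ → Bool) := PiNat.metricSpace
  obtain ⟨ε, hε, h⟩ := (@Metric.uniformContinuous_iff _ _ m.toPseudoMetricSpace _ _).1
    (@CompactSpace.uniformContinuous_of_continuous _ _ m.toUniformSpace _ _ _ hf) δ hδ
  obtain ⟨N, hN⟩ := exists_pow_lt_of_lt_one hε (show (1 / 2 : ℝ) < 1 by norm_num)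
  refine ⟨N, fun x y hxy => ?_⟩
  have h1 : dist x y ≤ (1 / 2) ^ N := PiNat.mem_cylinder_iff_dist_le.1 fun k hk => hxy k hk
  exact (h (h1.trans_lt hN)).le

/-- Every Cantor set contains Cantor sets parametrized with arbitrarily small modulus of
continuity. -/
theorem exists_reparametrization {f : (ℕ → Bool) → ℝ} (hf : Continuous f)
    (hinj : Function.Injective f) {δ : ℕ → ℝ} (hδ : ∀ n, 0 < δ n) :
    ∃ ψ : (ℕ → Bool) → ℝ, Continuous ψ ∧ Function.Injective ψ ∧ range ψ ⊆ range f ∧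
      ∀ n x y, (∀ k < n, x k = y k) → |ψ x - ψ y| ≤ δ n := by
  choose N hN using fun n => exists_modulus hf (hδ n)
  -- The `n`-th free bit is placed at position `p n ≥ N n` and all other bits are `false`; agreement
  -- of the first `n` bits then becomes agreement up to position `N n`.
  set p : ℕ → ℕ := fun n => ∑ k ∈ Finset.range (n + 1), (N k + 1) with hp
  have hpm : StrictMono p := strictMono_nat_of_lt_succ fun n => by
    rw [hp]; simp only; rw [Finset.sum_range_succ _ (n + 1)]; omega
  have hpN : ∀ n, N n ≤ p n := fun n => by
    rw [hp]; simp only; rw [Finset.sum_range_succ]; omega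
  set g : (ℕ → Bool) → ℕ → Bool := fun x => Function.extend p x fun _ => false with hg
  have hgp : ∀ x n, g x (p n) = x n := fun x n => hpm.injective.extend_apply x _ n
  have hgn : ∀ x j, (¬ ∃ n, p n = j) → g x j = false := fun x j h =>
    Function.extend_apply' _ _ _ h
  have hgc : Continuous g := by
    refine continuous_pi fun j => ?_
    by_cases h : ∃ n, p n = j
    · obtain ⟨n, rfl⟩ := h
      simp only [hgp]
      exact continuous_apply n
    · simp only [hgn _ j h]
      exact continuous_const
  have hgi : Function.Injective g := fun x y hxy => funext fun n => by
    rw [← hgp x, ← hgp y, hxy]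
  refine ⟨f ∘ g, hf.comp hgc, hinj.comp hgi, range_comp_subset_range g f, fun n x y hxy => ?_⟩
  refine hN n _ _ fun j hj => ?_
  by_cases h : ∃ m, p m = j
  · obtain ⟨m, rfl⟩ := h
    rw [hgp, hgp]
    exact hxy m (hpm.lt_iff_lt.1 (hj.trans_le (hpN n)))
  · rw [hgn x j h, hgn y j h]

theorem hasBoxBound_range {ψ : (ℕ → Bool) → ℝ}
    (h : ∀ n x y, (∀ k < n, x k = y k) → |ψ x - ψ y| ≤ 1 * (2 ^ n / (n ! : ℝ))) :
    HasBoxBound (range ψ) 0 := by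
  classical
  refine hasBoxBound_of_factorial (D := 2) le_rfl zero_le_one zero_lt_one two_pos fun n => ?_
  refine ⟨Finset.univ.image fun s : Fin n → Bool =>
    ψ fun k => if hk : k < n then s ⟨k, hk⟩ else false, ?_, ?_⟩
  · rintro _ ⟨x, rfl⟩
    refine ⟨_, Finset.mem_image_of_mem _ (Finset.mem_univ fun k : Fin n => x k), h n _ _ ?_⟩
    intro k hk
    simp [hk]
  · rw [Real.rpow_zero, mul_one]
    have : (Finset.univ.image fun s : Fin n → Bool =>
        ψ fun k => if hk : k < n then s ⟨k, hk⟩ else false).card ≤ 2 ^ n :=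
      Finset.card_image_le.trans (by simp)
    exact_mod_cast this

/-- The binary sequences with infinitely many ones. -/
def infinitelyOften : Set (ℕ → Bool) := {x | ∃ᶠ n in atTop, x n = true}

theorem measurableSet_infinitelyOften : MeasurableSet infinitelyOften := by
  have : infinitelyOften = ⋂ n : ℕ, ⋃ m : ℕ, {x | n ≤ m ∧ x m = true} := by
    ext x
    simp [infinitelyOften, frequently_atTop]
  rw [this]
  refine MeasurableSet.iInter fun n => MeasurableSet.iUnion fun m => ?_
  exact (MeasurableSet.const _).inter
    (measurableSet_eq_fun (measurable_pi_apply m) measurable_const)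

/-- The complement is `F_σ`, so otherwise Baire's theorem gives interior to a closed set inside one
of the two. But eventually false and eventually true sequences are both dense. -/
theorem not_isFSigmaSet_infinitelyOften : ¬ IsFSigmaSet infinitelyOften := by
  rintro ⟨F, hF, hFe⟩
  have hclosed : ∀ n : ℕ, IsClosed {x : ℕ → Bool | ∀ m, n ≤ m → x m = false} := fun n => by
    simp only [ofPred_forall]
    exact isClosed_iInter fun m => isClosed_iInter fun _ =>
      isClosed_eq (continuous_apply m) continuous_const
  have hflip : ∀ (x : ℕ → Bool) (V : Set (ℕ → Bool)), V ∈ 𝓝 x → ∀ b : Bool,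
      ∃ N, ∀ n ≥ N, (fun k => if k < n then x k else b) ∈ V := by
    intro x V hV b
    have : Tendsto (fun n k => if k < n then x k else b) atTop (𝓝 x) := by
      refine tendsto_pi_nhds.2 fun k => tendsto_const_nhds.congr' ?_
      filter_upwards [eventually_gt_atTop k] with n hn
      simp [hn]
    exact eventually_atTop.1 (this hV)
  obtain ⟨i, x, hx⟩ := nonempty_interior_of_iUnion_of_closed
    (f := Sum.elim F fun n => {x : ℕ → Bool | ∀ m, n ≤ m → x m = false})
    (by rintro (n | n); exacts [hF n, hclosed n]) (by
      rw [eq_univ_iff_forall]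
      intro x
      by_cases h : x ∈ infinitelyOften
      · rw [hFe] at h
        obtain ⟨n, hn⟩ := mem_iUnion.1 h
        exact mem_iUnion.2 ⟨Sum.inl n, hn⟩
      · obtain ⟨n, hn⟩ := eventually_atTop.1 (not_frequently.1 h)
        exact mem_iUnion.2 ⟨Sum.inr n, fun m hm => by simpa using hn m hm⟩)
  rw [mem_interior_iff_mem_nhds] at hx
  rcases i with n | n
  · obtain ⟨N, hN⟩ := hflip x _ hx false
    have h1 : (fun k => if k < N then x k else false) ∈ infinitelyOften :=
      hFe ▸ mem_iUnion.2 ⟨n, hN N le_rfl⟩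
    obtain ⟨m, hm, hm2⟩ := (frequently_atTop.1 h1) N
    simp [not_lt.2 hm] at hm2
  · obtain ⟨N, hN⟩ := hflip x _ hx true
    have h1 := hN (max N n) (le_max_left _ _) (max N n) (le_max_right _ _)
    simp at h1

/-! ### Groups generated by independent sets -/

section Independent

variable {W : Submodule ℚ ℝ} {B C : Set ℝ} {G : AddSubgroup ℝ}

theorem closure_le_span (B : Set ℝ) :
    AddSubgroup.closure B ≤ (Submodule.span ℚ B).toAddSubgroup :=
  (AddSubgroup.closure_le _).2 Submodule.subset_span

theorem inf_closure_eq_bot (hB : LinearIndepOn ℚ W.mkQ B) (hG : (G : Set ℝ) ⊆ W) :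
    G ⊓ AddSubgroup.closure B = ⊥ := by
  rw [eq_bot_iff]
  rintro x ⟨hxG, hxB⟩
  have hd := Submodule.range_ker_disjoint (v := (Subtype.val : B → ℝ)) (f := W.mkQ) hB
  rw [Subtype.range_coe, Submodule.ker_mkQ] at hd
  exact (Submodule.disjoint_def.1 hd) x (closure_le_span B hxB) (hG hxG)

/-- Modulo `W` the group `G` vanishes, so a point of `C` outside `B` would depend on `B`. Hence `G +
H` meets `C` only in `B` and inherits its complexity. -/
theorem mem_of_mem_sup_closure (hC : LinearIndepOn ℚ W.mkQ C) (hBC : B ⊆ C)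
    (hG : (G : Set ℝ) ⊆ W) {x : ℝ} (hxC : x ∈ C) (hx : x ∈ G ⊔ AddSubgroup.closure B) :
    x ∈ B := by
  by_contra hxB
  obtain ⟨g, hg, h, hh, rfl⟩ := AddSubgroup.mem_sup.1 hx
  refine linearIndepOn_iff_notMem_span.1 hC _ hxC ?_
  have h1 : W.mkQ g = 0 := by
    rw [Submodule.mkQ_apply, Submodule.Quotient.mk_eq_zero]; exact hG hg
  rw [map_add, h1, zero_add, Submodule.span_image]
  refine Submodule.mem_map_of_mem (Submodule.span_mono ?_ (closure_le_span B hh))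
  exact fun b hb => ⟨hBC hb, fun hbx => hxB (mem_singleton_iff.1 hbx ▸ hb)⟩

/-- If some `x i` were not among the `y j`, the relation could be solved for it modulo `W`, as its
coefficient is nonzero. -/
theorem range_subset_range_of_sum_sub_mem (hB : LinearIndepOn ℚ W.mkQ B) {n : ℕ} {c : Fin n → ℤ}
    (hc : ∀ i, c i ≠ 0) {x y : Fin n → ℝ} (hx : ∀ i, x i ∈ B) (hy : ∀ i, y i ∈ B)
    (hxi : Function.Injective x) (h : ∑ i, c i • x i - ∑ i, c i • y i ∈ W) :
    range x ⊆ range y := by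
  rintro _ ⟨i, rfl⟩
  by_contra hcon
  refine linearIndepOn_iff_notMem_span.1 hB _ (hx i) ?_
  set P := Submodule.span ℚ (W.mkQ '' (B \ {x i}))
  have hmem : ∀ b ∈ B, b ≠ x i → ∀ k : ℤ, k • W.mkQ b ∈ P := fun b hb hne k => by
    have hb' : W.mkQ b ∈ P := Submodule.subset_span ⟨b, ⟨hb, hne⟩, rfl⟩
    exact zsmul_mem hb' k
  have h1 : W.mkQ (∑ i, c i • x i - ∑ i, c i • y i) = 0 := by
    rw [Submodule.mkQ_apply, Submodule.Quotient.mk_eq_zero]; exact h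
  simp only [map_sub, map_sum, map_zsmul] at h1
  rw [← Finset.add_sum_erase _ _ (Finset.mem_univ i)] at h1
  have h2 : c i • W.mkQ (x i) ∈ P := by
    have h3 : c i • W.mkQ (x i) = ∑ j, c j • W.mkQ (y j) -
        ∑ j ∈ Finset.univ.erase i, c j • W.mkQ (x j) := by
      rw [← sub_eq_zero, ← h1]; abel
    rw [h3]
    refine sub_mem (sum_mem fun j _ => hmem _ (hy j) (fun h => hcon ⟨j, h⟩) _)
      (sum_mem fun j hj => hmem _ (hx j) (fun h => (Finset.ne_of_mem_erase hj) (hxi h)) _)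
  have h4 := P.smul_mem ((c i : ℚ)⁻¹) h2
  rwa [← Int.cast_smul_eq_zsmul ℚ, smul_smul, inv_mul_cancel₀ (by exact_mod_cast hc i),
    one_smul] at h4

theorem exists_strictMono_sum_of_mem_closure {x : ℝ} (hx : x ∈ AddSubgroup.closure B) :
    ∃ (n : ℕ) (c : Fin n → ℤ) (y : Fin n → ℝ), (∀ i, c i ≠ 0) ∧ StrictMono y ∧ (∀ i, y i ∈ B) ∧
      x = ∑ i, c i • y i := by
  rw [← Submodule.span_int_eq_addSubgroupClosure] at hx
  obtain ⟨c, hcB, hcx⟩ := Submodule.mem_span_set.1 hx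
  let e := c.support.orderIsoOfFin rfl
  refine ⟨c.support.card, fun i => c (e i), fun i => e i, fun i => ?_, ?_, fun i => ?_, ?_⟩
  · exact Finsupp.mem_support_iff.1 (e i).2
  · exact fun i j hij => e.strictMono hij
  · exact hcB (e i).2
  · rw [← hcx, Finsupp.sum, ← Finset.sum_coe_sort]
    exact (e.toEquiv.sum_comp fun i : c.support => c i • (i : ℝ)).symm

/-- For fixed nonzero coefficients, summation is injective on `G` times the increasing tuples in
`B`, so Lusin–Souslin applies; ordering the tuples removes the permutations. -/
theorem measurableSet_sup_closure (hB : LinearIndepOn ℚ W.mkQ B) (hBm : MeasurableSet B)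
    (hG : (G : Set ℝ) ⊆ W) (hGm : MeasurableSet (G : Set ℝ)) :
    MeasurableSet ((G ⊔ AddSubgroup.closure B : AddSubgroup ℝ) : Set ℝ) := by
  let T : (n : ℕ) → Set (ℝ × (Fin n → ℝ)) := fun n =>
    (G : Set ℝ) ×ˢ {y : Fin n → ℝ | StrictMono y ∧ ∀ i, y i ∈ B}
  have hT : ∀ n, MeasurableSet (T n) := fun n => by
    refine hGm.prod (MeasurableSet.inter (s₁ := {y : Fin n → ℝ | StrictMono y}) ?_ ?_)
    · have h : {y : Fin n → ℝ | StrictMono y} =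
          ⋂ (i : Fin n) (j : Fin n) (_ : i < j), {y | y i < y j} := by
        ext y; simp [StrictMono]
      rw [h]
      exact MeasurableSet.iInter fun i => MeasurableSet.iInter fun j => MeasurableSet.iInter fun _ =>
        measurableSet_lt (measurable_pi_apply i) (measurable_pi_apply j)
    · have h : {y : Fin n → ℝ | ∀ i, y i ∈ B} = ⋂ i, (fun y => y i) ⁻¹' B := by
        ext y; simp
      change MeasurableSet {y : Fin n → ℝ | ∀ i, y i ∈ B}
      rw [h]
      exact MeasurableSet.iInter fun i => measurable_pi_apply i hBm
  have hunion : ((G ⊔ AddSubgroup.closure B : AddSubgroup ℝ) : Set ℝ) =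
      ⋃ (n : ℕ) (c : {c : Fin n → ℤ // ∀ i, c i ≠ 0}),
        (fun p : ℝ × (Fin n → ℝ) => p.1 + ∑ i, c.1 i • p.2 i) '' T n := by
    apply Subset.antisymm
    · intro x hx
      obtain ⟨g, hg, h, hh, rfl⟩ := AddSubgroup.mem_sup.1 hx
      obtain ⟨n, c, y, hc, hy, hyB, rfl⟩ := exists_strictMono_sum_of_mem_closure hh
      exact mem_iUnion₂.2 ⟨n, ⟨c, hc⟩, (g, y), ⟨hg, hy, hyB⟩, rfl⟩
    · refine iUnion₂_subset fun n c => ?_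
      rintro _ ⟨⟨g, y⟩, ⟨hg, -, hyB⟩, rfl⟩
      refine AddSubgroup.mem_sup.2 ⟨g, hg, _, sum_mem fun i _ => ?_, rfl⟩
      exact zsmul_mem (AddSubgroup.subset_closure (hyB i)) _
  rw [hunion]
  refine MeasurableSet.iUnion fun n => MeasurableSet.iUnion fun c => ?_
  refine (hT n).image_of_continuousOn_injOn (Continuous.continuousOn ?_) ?_
  · simp only [zsmul_eq_mul]
    fun_prop
  · rintro ⟨g, y⟩ ⟨hg, hy, hyB⟩ ⟨g', y'⟩ ⟨hg', hy', hyB'⟩ heq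
    simp only at heq hg hg' hy hy' hyB hyB'
    have h1 : ∑ i, c.1 i • y i - ∑ i, c.1 i • y' i ∈ W := by
      have : ∑ i, c.1 i • y i - ∑ i, c.1 i • y' i = g' - g := by linarith
      rw [this]
      exact sub_mem (hG hg') (hG hg)
    have h2 : ∑ i, c.1 i • y' i - ∑ i, c.1 i • y i ∈ W := by
      rw [← neg_sub]; exact neg_mem h1
    have h3 : y = y' := (hy.range_inj hy').1 (Subset.antisymm
      (range_subset_range_of_sum_sub_mem hB c.2 hyB hyB' hy.injective h1)
      (range_subset_range_of_sum_sub_mem hB c.2 hyB' hyB hy'.injective h2))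
    subst h3
    exact Prod.ext (add_right_cancel heq) rfl

end Independent

/-! ### Packing dimension of generated groups, and the final construction -/

theorem closure_subset_iUnion_nsmul_sub {B K : Set ℝ} (hBK : B ⊆ K) :
    (AddSubgroup.closure B : Set ℝ) ⊆ ⋃ p : ℕ × ℕ, (p.1 • K - p.2 • K) := by
  let S : AddSubgroup ℝ :=
    { carrier := ⋃ p : ℕ × ℕ, (p.1 • K - p.2 • K)
      zero_mem' := mem_iUnion.2 ⟨(0, 0), by simp⟩
      add_mem' := by
        intro x y hx hy
        obtain ⟨p, a, ha, b, hb, rfl⟩ := mem_iUnion.1 hx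
        obtain ⟨q, c, hc, d, hd, rfl⟩ := mem_iUnion.1 hy
        refine mem_iUnion.2 ⟨(p.1 + q.1, p.2 + q.2), a + c, ?_, b + d, ?_, ?_⟩
        · simp only [add_nsmul]; exact add_mem_add ha hc
        · simp only [add_nsmul]; exact add_mem_add hb hd
        · simp only; ring
      neg_mem' := by
        intro x hx
        obtain ⟨p, a, ha, b, hb, rfl⟩ := mem_iUnion.1 hx
        exact mem_iUnion.2 ⟨(p.2, p.1), b, hb, a, ha, by simp⟩ }
  refine (AddSubgroup.closure_le S).2 fun x hx => mem_iUnion.2 ⟨(1, 0), x, ?_, 0, ?_, by simp⟩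
  · simpa using hBK hx
  · simp

theorem packingDim_sup_closure_le {ι : Type*} [Countable ι] {G : AddSubgroup ℝ} {F : ι → Set ℝ}
    {B K : Set ℝ} {s : ℝ} (hs : 0 ≤ s) (hG : (G : Set ℝ) ⊆ ⋃ i, F i)
    (hF : ∀ i, HasBoxBound (F i) s) (hBK : B ⊆ K) (hK : HasBoxBound K 0) :
    packingDim ((G ⊔ AddSubgroup.closure B : AddSubgroup ℝ) : Set ℝ) ≤ ENNReal.ofReal s := by
  refine packingDim_le (F := fun q : ι × (ℕ × ℕ) => F q.1 + (q.2.1 • K - q.2.2 • K)) hs ?_ ?_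
  · intro x hx
    obtain ⟨g, hg, h, hh, rfl⟩ := AddSubgroup.mem_sup.1 hx
    obtain ⟨i, hi⟩ := mem_iUnion.1 (hG hg)
    obtain ⟨p, hp⟩ := mem_iUnion.1 (closure_subset_iUnion_nsmul_sub hBK hh)
    exact mem_iUnion.2 ⟨(i, p), add_mem_add hi hp⟩
  · rintro ⟨i, p⟩
    have h1 : HasBoxBound (p.1 • K - p.2 • K) 0 := by
      rw [sub_eq_add_neg]
      simpa using (hK.nsmul p.1).add (hK.nsmul p.2).neg
    simpa using (hF i).add h1

theorem not_isFSigmaSet_of_preimage_eq {A : Set ℝ} {f : (ℕ → Bool) → ℝ} (hf : Continuous f)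
    (h : f ⁻¹' A = infinitelyOften) : ¬ IsFSigmaSet A := fun hA =>
  not_isFSigmaSet_infinitelyOften (h ▸ hA.preimage hf)

theorem typical_compact_properties (C : TopologicalSpace.NonemptyCompacts ℝ)
    (hC : LinearIndepOn ℚ erdosVolkmannSpan.mkQ (C : Set ℝ))
    (hperf : ∀ n : ℕ, ∀ x ∈ (C : Set ℝ), ∃ y ∈ (C : Set ℝ), y ≠ x ∧
      dist x y < 1 / ((n : ℝ) + 1)) :
    IsCantorSpace (C : Set ℝ) ∧
      LinearIndependent ℚ (fun x : (C : Set ℝ) => (x : ℝ)) ∧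
      ∃ (K B : Set ℝ) (H : AddSubgroup ℝ),
        K ⊆ (C : Set ℝ) ∧ IsCantorSpace K ∧ packingDim K = 0 ∧
        B ⊆ K ∧ MeasurableSet B ∧ ¬ IsFSigmaSet B ∧
        H = AddSubgroup.closure B ∧
        MeasurableSet (H : Set ℝ) ∧ ¬ IsFSigmaSet (H : Set ℝ) ∧ packingDim (H : Set ℝ) = 0 ∧
        (∀ α : ℝ, 0 ≤ α → α < 1 →
          erdosVolkmannGroup α ⊓ H = ⊥ ∧
          MeasurableSet ((erdosVolkmannGroup α ⊔ H : AddSubgroup ℝ) : Set ℝ) ∧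
          ¬ IsFSigmaSet ((erdosVolkmannGroup α ⊔ H : AddSubgroup ℝ) : Set ℝ) ∧
          Immeasurable ((erdosVolkmannGroup α ⊔ H : AddSubgroup ℝ) : Set ℝ) ∧
          dimH ((erdosVolkmannGroup α ⊔ H : AddSubgroup ℝ) : Set ℝ) = ENNReal.ofReal α ∧
          packingDim ((erdosVolkmannGroup α ⊔ H : AddSubgroup ℝ) : Set ℝ) = ENNReal.ofReal α) ∧
        ∃ G : AddSubgroup ℝ,
          (G : Set ℝ) = ⋃ n : ℕ,
            ((erdosVolkmannGroup (1 - 1 / ((n : ℝ) + 1)) ⊔ H : AddSubgroup ℝ) : Set ℝ) ∧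
          Immeasurable (G : Set ℝ) ∧ dimH (G : Set ℝ) = 1 ∧ packingDim (G : Set ℝ) = 1 := by
  have hli : LinearIndepOn ℚ id (C : Set ℝ) :=
    LinearIndependent.of_comp erdosVolkmannSpan.mkQ hC
  obtain ⟨e⟩ := nonempty_homeomorph_nat_bool_of_linearIndepOn C.isCompact C.nonempty hli hperf
  obtain ⟨f, hf, hfi, hfC, hfδ⟩ := exists_reparametrization
    (continuous_subtype_val.comp e.continuous) (Subtype.val_injective.comp e.injective)
    (δ := fun n => 1 * (2 ^ n / (n ! : ℝ))) (fun n => by positivity)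
  have hKC : range f ⊆ (C : Set ℝ) := hfC.trans (by
    rintro _ ⟨x, rfl⟩; exact (e x).2)
  have hK : HasBoxBound (range f) 0 := hasBoxBound_range hfδ
  have hfB : f '' infinitelyOften ⊆ range f := image_subset_range _ _
  have hBC := hfB.trans hKC
  set B := f '' infinitelyOften with hB
  have : PolishSpace Bool := inferInstance
  have hBm : MeasurableSet B :=
    measurableSet_infinitelyOften.image_of_continuousOn_injOn hf.continuousOn hfi.injOn
  have hBli : LinearIndepOn ℚ erdosVolkmannSpan.mkQ B := hC.mono hBC
  set H := AddSubgroup.closure B with hH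
  -- One identity gives non-`F_σ` for `H` itself (`G = ⊥`), for each `G_α + H`, and for the
  -- increasing union.
  have hpre : ∀ G : AddSubgroup ℝ, (G : Set ℝ) ⊆ erdosVolkmannSpan →
      f ⁻¹' ((G ⊔ H : AddSubgroup ℝ) : Set ℝ) = infinitelyOften := by
    intro G hG
    ext u
    constructor
    · intro hu
      exact (hfi.mem_set_image).1 (mem_of_mem_sup_closure hC hBC hG (hKC ⟨u, rfl⟩) hu)
    · exact fun hu => AddSubgroup.mem_sup_right (AddSubgroup.subset_closure ⟨u, hu, rfl⟩)
  have hbot : ((⊥ : AddSubgroup ℝ) : Set ℝ) ⊆ erdosVolkmannSpan := by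
    rintro x rfl; exact zero_mem _
  have hz : ENNReal.ofReal 0 = 0 := ENNReal.ofReal_zero
  have hHm : MeasurableSet (H : Set ℝ) := by
    have := measurableSet_sup_closure hBli hBm hbot (by simp)
    rwa [bot_sup_eq] at this
  have hHF : ¬ IsFSigmaSet (H : Set ℝ) := by
    have := not_isFSigmaSet_of_preimage_eq hf (hpre ⊥ hbot)
    rwa [bot_sup_eq] at this
  have hHp : packingDim (H : Set ℝ) ≤ 0 := by
    have := packingDim_sup_closure_le (G := ⊥) (F := fun _ : Unit => {(0 : ℝ)}) le_rfl (by simp)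
      (fun _ => hasBoxBound_singleton 0) hfB hK
    rwa [bot_sup_eq, hz] at this
  have hKp : packingDim (range f) ≤ 0 := by
    have := packingDim_le (F := fun _ : Unit => range f) le_rfl
      (subset_iUnion (fun _ : Unit => range f) ()) fun _ => hK
    rwa [hz] at this
  have hm : ∀ α : ℝ, 0 ≤ α → α < 1 →
      MeasurableSet ((erdosVolkmannGroup α ⊔ H : AddSubgroup ℝ) : Set ℝ) := fun α h0 h1 =>
    measurableSet_sup_closure hBli hBm (erdosVolkmannGroup_le_span h1)
      (isFSigmaSet_erdosVolkmannGroup h0 h1.le).measurableSet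
  have hdim : ∀ α : ℝ, 0 ≤ α → α < 1 →
      dimH ((erdosVolkmannGroup α ⊔ H : AddSubgroup ℝ) : Set ℝ) = ENNReal.ofReal α ∧
      packingDim ((erdosVolkmannGroup α ⊔ H : AddSubgroup ℝ) : Set ℝ) = ENNReal.ofReal α := by
    intro α h0 h1
    refine dimH_eq_and_packingDim_eq ((le_dimH_erdosVolkmannGroup h1.le).trans (dimH_mono ?_)) ?_
    · exact SetLike.coe_subset_coe.2 le_sup_left
    · exact packingDim_sup_closure_le h0 (erdosVolkmannGroup_eq_iUnion h0).subset
        (hasBoxBound_erdosVolkmannPiece h0 h1.le) hfB hK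
  refine ⟨isCantorSpace_of_homeomorph e, hli, range f, B, H, hKC,
    isCantorSpace_of_homeomorph (hf.isClosedEmbedding hfi).isEmbedding.toHomeomorph,
    le_antisymm hKp zero_le, hfB, hBm,
    not_isFSigmaSet_of_preimage_eq hf (preimage_image_eq _ hfi), rfl, hHm, hHF,
    le_antisymm hHp zero_le, ?_, ?_⟩
  · intro α h0 h1
    have hF := not_isFSigmaSet_of_preimage_eq hf (hpre _ (erdosVolkmannGroup_le_span h1))
    exact ⟨inf_closure_eq_bot hBli (erdosVolkmannGroup_le_span h1), hm α h0 h1, hF,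
      immeasurable_of_not_isFSigmaSet _ (hm α h0 h1) hF, hdim α h0 h1⟩
  · have hdir : Directed (· ≤ ·) fun n : ℕ => erdosVolkmannGroup (1 - 1 / ((n : ℝ) + 1)) ⊔ H := by
      refine Monotone.directed_le fun m n hmn => sup_le_sup_right (erdosVolkmannGroup_mono ?_) H
      gcongr
    have hcoe := AddSubgroup.coe_iSup_of_directed hdir
    refine ⟨_, hcoe, immeasurable_of_not_isFSigmaSet _ ?_ ?_, ?_⟩
    · rw [hcoe]
      exact MeasurableSet.iUnion fun n => hm _ (one_sub_one_div_mem n).1 (one_sub_one_div_mem n).2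
    · refine not_isFSigmaSet_of_preimage_eq hf ?_
      rw [hcoe, preimage_iUnion]
      simp_rw [hpre _ (erdosVolkmannGroup_le_span (one_sub_one_div_mem _).2)]
      exact iUnion_const _
    · refine dimH_eq_and_packingDim_eq ?_ ?_
      · rw [hcoe, dimH_iUnion]
        simp_rw [fun n : ℕ => (hdim _ (one_sub_one_div_mem n).1 (one_sub_one_div_mem n).2).1]
        have hlim : Tendsto (fun n : ℕ => ENNReal.ofReal (1 - 1 / ((n : ℝ) + 1))) atTop (𝓝 1) := by
          have := ENNReal.tendsto_ofReal (tendsto_one_div_add_atTop_nhds_zero_nat.const_sub (1 : ℝ))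
          simpa using this
        exact le_of_tendsto' hlim fun n =>
          le_iSup (fun n : ℕ => ENNReal.ofReal (1 - 1 / ((n : ℝ) + 1))) n
      · rw [← iSup_sup, ← ENNReal.ofReal_one]
        have hdir' : Directed (· ≤ ·) fun n : ℕ => erdosVolkmannGroup (1 - 1 / ((n : ℝ) + 1)) :=
          Monotone.directed_le fun m n hmn => erdosVolkmannGroup_mono (by gcongr)
        refine packingDim_sup_closure_le (F := fun q : ℕ × ℕ =>
          erdosVolkmannPiece (1 - 1 / ((q.1 : ℝ) + 1)) q.2) zero_le_one ?_ (fun q => ?_) hfB hK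
        · rw [AddSubgroup.coe_iSup_of_directed hdir', iUnion_prod']
          exact iUnion_mono fun n => (erdosVolkmannGroup_eq_iUnion (one_sub_one_div_mem n).1).subset
        · have h := one_sub_one_div_mem q.1
          exact (hasBoxBound_erdosVolkmannPiece h.1 h.2.le q.2).of_le h.2.le

theorem mainTheorem8 :
    -- immeasurable additive subgroups of every Hausdorff and packing dimension
    (∀ α : ℝ, 0 ≤ α → α ≤ 1 → ∃ G : AddSubgroup ℝ,
      Immeasurable (G : Set ℝ) ∧
      dimH (G : Set ℝ) = ENNReal.ofReal α ∧ packingDim (G : Set ℝ) = ENNReal.ofReal α) ∧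
    -- the groups `G α` form an increasing family of `F_σ` groups of dimension `α`
    (∀ α β : ℝ, 0 ≤ α → α ≤ β → erdosVolkmannGroup α ≤ erdosVolkmannGroup β) ∧
    (∀ α : ℝ, 0 ≤ α → α < 1 →
      IsFSigmaSet (erdosVolkmannGroup α : Set ℝ) ∧
      dimH (erdosVolkmannGroup α : Set ℝ) = ENNReal.ofReal α ∧
      packingDim (erdosVolkmannGroup α : Set ℝ) = ENNReal.ofReal α) ∧
    -- a typical compact set `C` is an independent Cantor set that carries a suitable group `H`
    (∀ᶠ C : TopologicalSpace.NonemptyCompacts ℝ in residual (TopologicalSpace.NonemptyCompacts ℝ),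
      IsCantorSpace (C : Set ℝ) ∧
      LinearIndependent ℚ (fun x : (C : Set ℝ) => (x : ℝ)) ∧
      ∃ (K B : Set ℝ) (H : AddSubgroup ℝ),
        K ⊆ (C : Set ℝ) ∧ IsCantorSpace K ∧ packingDim K = 0 ∧
        B ⊆ K ∧ MeasurableSet B ∧ ¬ IsFSigmaSet B ∧
        H = AddSubgroup.closure B ∧
        MeasurableSet (H : Set ℝ) ∧ ¬ IsFSigmaSet (H : Set ℝ) ∧ packingDim (H : Set ℝ) = 0 ∧
        (∀ α : ℝ, 0 ≤ α → α < 1 →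
          erdosVolkmannGroup α ⊓ H = ⊥ ∧
          MeasurableSet ((erdosVolkmannGroup α ⊔ H : AddSubgroup ℝ) : Set ℝ) ∧
          ¬ IsFSigmaSet ((erdosVolkmannGroup α ⊔ H : AddSubgroup ℝ) : Set ℝ) ∧
          Immeasurable ((erdosVolkmannGroup α ⊔ H : AddSubgroup ℝ) : Set ℝ) ∧
          dimH ((erdosVolkmannGroup α ⊔ H : AddSubgroup ℝ) : Set ℝ) = ENNReal.ofReal α ∧
          packingDim ((erdosVolkmannGroup α ⊔ H : AddSubgroup ℝ) : Set ℝ) = ENNReal.ofReal α) ∧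
        ∃ G : AddSubgroup ℝ,
          (G : Set ℝ) = ⋃ n : ℕ,
            ((erdosVolkmannGroup (1 - 1 / ((n : ℝ) + 1)) ⊔ H : AddSubgroup ℝ) : Set ℝ) ∧
          Immeasurable (G : Set ℝ) ∧ dimH (G : Set ℝ) = 1 ∧ packingDim (G : Set ℝ) = 1) := by
  have htyp := (eventually_residual_linearIndepOn _ isFSigmaSet_erdosVolkmannSpan
    volume_erdosVolkmannSpan).and eventually_residual_forall_exists_ne
  refine ⟨fun α h0 h1 => ?_, fun α β _ h => erdosVolkmannGroup_mono h, fun α h0 h1 =>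
    ⟨isFSigmaSet_erdosVolkmannGroup h0 h1.le, dimH_eq_and_packingDim_eq
      (le_dimH_erdosVolkmannGroup h1.le) (packingDim_erdosVolkmannGroup_le h0 h1.le)⟩,
    htyp.mono fun C hC => typical_compact_properties C hC.1 hC.2⟩
  -- A typical `C` exists by Baire's theorem; `G_α + H` serves `α < 1`, and the union serves `α =
  -- 1`.
  obtain ⟨C, hC⟩ := (dense_of_mem_residual htyp).nonempty
  obtain ⟨-, -, -, -, H, -, -, -, -, -, -, -, -, -, -, hH, G, -, hG⟩ :=
    typical_compact_properties C hC.1 hC.2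
  rcases h1.lt_or_eq with h1 | rfl
  · obtain ⟨-, -, -, h⟩ := hH α h0 h1
    exact ⟨_, h⟩
  · exact ⟨G, by simpa using hG⟩
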